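/- Let $n\ge 2$. The singular braid monoid $SB_n$ has generators $\sigma_i,\sigma_i^{-1},x_i$ ($1\le i\le n-1$) and relations $\sigma_i\sigma_j=\sigma_j\sigma_i$ and $x_ix_j=x_jx_i$ for $|i-j|>1$; $x_i\sigma_j=\sigma_jx_i$ for $|i-j|\neq1$; $\sigma_i\sigma_{i+1}\sigma_i=\sigma_{i+1}\sigma_i\sigma_{i+1}$; $\sigma_i\sigma_{i+1}x_i=x_{i+1}\sigma_i\sigma_{i+1}$; $\sigma_{i+1}\sigma_ix_{i+1}=x_i\sigma_{i+1}\sigma_i$; $\sigma_i\sigma_i^{-1}=\sigma_i^{-1}\sigma_i=1$. The positive singular braid monoid $SB_n^+$ is the monoid with generators $\sigma_i,x_i$ and all of these relations except the last one, and $Br_n^+$ is the positive braid monoid, with generators $\sigma_i$ and the braid relations. Put $\Delta=(\sigma_1\cdots\sigma_{n-1})(\sigma_1\cdots\sigma_{n-2})\cdots(\sigma_1\sigma_2)\sigma_1$. A fragment (positive permutation braid) is an element $A\in Br_n^+$ with $\Delta=BAC$ for some $B,C\in Br_n^+$. The left-greedy fragments of $S\in Br_n^+$ are a sequence of non-trivial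 fragments $A_1,\dots,A_m$ with $S=A_1\cdots A_m$ such that each $A_j$ has maximal length among the fragments that are left divisors of $A_jA_{j+1}\cdots A_m$. A left-greedy form is an expression $\Delta^tS_1X_1\cdots S_kX_k$, with $t\in\mathbb Z$ and $k\ge0$, where each $S_i$ is a sequence of fragments and each $X_i$ is a word in the letters $x_1,\dots,x_{n-1}$, such that, in $SB_n^+$: (a) $S_1X_1\cdots S_kX_k$ is not left divisible by $\Delta$; (b) the product of the sequence $S_i$ has maximal length among the elements of $Br_n^+$ that are left divisors of $S_iX_i\cdots S_kX_k$, and $S_i$ is the sequence of left-greedy fragments of this product; (c) each $X_i$ is lexicographically ordered: each letter $x_j$ of $X_i$ is the one of smallest index among the singular generators that are left divisors of the remaining product, that is, of the product that starts at this letter and runs to the end of the expression; and, if the letter is not the last one of $X_i$, then the product that follows it has no non-trivial left divisor in $Br_n^+$; (d) only $S_1$ and $X_k$ may be empty, and no block $S_iX_i$ is empty. A right-greedy form is defined in the same way from right to left: it is an expression $X_kS_k\cdots X_1S_1\Delta^t$, subject to the mirror images of the above conditions (left divisors are replaced by right divisors, and the factors are split off from the right). Theorem. Each element of $SB_n$ can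 be written in exactly one way in a left-greedy form, and in exactly one way in a right-greedy form. Here a form is the datum of $t$, of the sequences of fragments $S_i$ (elements of $Br_n^+$) and of the words $X_i$. -/

import Mathlib

namespace SingularBraid

/-! The generators `σ₁, …, σₙ₋₁` (and `x₁, …, xₙ₋₁`) are indexed by `Fin (n - 1)`,
so that the index `i : Fin (n - 1)` stands for the generator with number `i + 1`. -/

/-- Artin's relations of the positive braid monoid. -/
inductive BraidRel (n : ℕ) :
    FreeMonoid (Fin (n - 1)) → FreeMonoid (Fin (n - 1)) → Prop
  | comm (i j : Fin (n - 1)) (h : 1 < |(i : ℤ) - (j : ℤ)|) :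
      BraidRel n (.of i * .of j) (.of j * .of i)
  | braid (i j : Fin (n - 1)) (h : (j : ℕ) = (i : ℕ) + 1) :
      BraidRel n (.of i * .of j * .of i) (.of j * .of i * .of j)

/-- The positive braid monoid `Brₙ⁺`. -/
abbrev BrPos (n : ℕ) : Type := PresentedMonoid (BraidRel n)

/-- The generators of the positive singular braid monoid: `σᵢ` and the singular `xᵢ`. -/
inductive PosGen (n : ℕ) : Type
  | sigma (i : Fin (n - 1)) : PosGen n
  | sing (i : Fin (n - 1)) : PosGen n

open PosGen in
/-- The defining relations of the positive singular braid monoid. -/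
inductive SingPosRel (n : ℕ) :
    FreeMonoid (PosGen n) → FreeMonoid (PosGen n) → Prop
  | sigma_comm (i j : Fin (n - 1)) (h : 1 < |(i : ℤ) - (j : ℤ)|) :
      SingPosRel n (.of (sigma i) * .of (sigma j)) (.of (sigma j) * .of (sigma i))
  | sing_comm (i j : Fin (n - 1)) (h : 1 < |(i : ℤ) - (j : ℤ)|) :
      SingPosRel n (.of (sing i) * .of (sing j)) (.of (sing j) * .of (sing i))
  | sing_sigma_comm (i j : Fin (n - 1)) (h : |(i : ℤ) - (j : ℤ)| ≠ 1) :
      SingPosRel n (.of (sing i) * .of (sigma j)) (.of (sigma j) * .of (sing i))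
  | braid (i j : Fin (n - 1)) (h : (j : ℕ) = (i : ℕ) + 1) :
      SingPosRel n (.of (sigma i) * .of (sigma j) * .of (sigma i))
        (.of (sigma j) * .of (sigma i) * .of (sigma j))
  | mixed_up (i j : Fin (n - 1)) (h : (j : ℕ) = (i : ℕ) + 1) :
      SingPosRel n (.of (sigma i) * .of (sigma j) * .of (sing i))
        (.of (sing j) * .of (sigma i) * .of (sigma j))
  | mixed_down (i j : Fin (n - 1)) (h : (j : ℕ) = (i : ℕ) + 1) :
      SingPosRel n (.of (sigma j) * .of (sigma i) * .of (sing j))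
        (.of (sing i) * .of (sigma j) * .of (sigma i))

/-- The positive singular braid monoid `SBₙ⁺`. -/
abbrev SBPos (n : ℕ) : Type := PresentedMonoid (SingPosRel n)

/-- The generators of the singular braid monoid: `σᵢ`, `σᵢ⁻¹` and the singular `xᵢ`. -/
inductive Gen (n : ℕ) : Type
  | sigma (i : Fin (n - 1)) : Gen n
  | sigmaInv (i : Fin (n - 1)) : Gen n
  | sing (i : Fin (n - 1)) : Gen n

open Gen in
/-- The defining relations of the singular (Baez–Birman) braid monoid. -/
inductive SingRel (n : ℕ) : FreeMonoid (Gen n) → FreeMonoid (Gen n) → Prop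
  | sigma_comm (i j : Fin (n - 1)) (h : 1 < |(i : ℤ) - (j : ℤ)|) :
      SingRel n (.of (sigma i) * .of (sigma j)) (.of (sigma j) * .of (sigma i))
  | sing_comm (i j : Fin (n - 1)) (h : 1 < |(i : ℤ) - (j : ℤ)|) :
      SingRel n (.of (sing i) * .of (sing j)) (.of (sing j) * .of (sing i))
  | sing_sigma_comm (i j : Fin (n - 1)) (h : |(i : ℤ) - (j : ℤ)| ≠ 1) :
      SingRel n (.of (sing i) * .of (sigma j)) (.of (sigma j) * .of (sing i))
  | braid (i j : Fin (n - 1)) (h : (j : ℕ) = (i : ℕ) + 1) :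
      SingRel n (.of (sigma i) * .of (sigma j) * .of (sigma i))
        (.of (sigma j) * .of (sigma i) * .of (sigma j))
  | mixed_up (i j : Fin (n - 1)) (h : (j : ℕ) = (i : ℕ) + 1) :
      SingRel n (.of (sigma i) * .of (sigma j) * .of (sing i))
        (.of (sing j) * .of (sigma i) * .of (sigma j))
  | mixed_down (i j : Fin (n - 1)) (h : (j : ℕ) = (i : ℕ) + 1) :
      SingRel n (.of (sigma j) * .of (sigma i) * .of (sing j))
        (.of (sing i) * .of (sigma j) * .of (sigma i))
  | mul_inv (i : Fin (n - 1)) : SingRel n (.of (sigma i) * .of (sigmaInv i)) 1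
  | inv_mul (i : Fin (n - 1)) : SingRel n (.of (sigmaInv i) * .of (sigma i)) 1

/-- The singular braid monoid `SBₙ`. -/
abbrev SB (n : ℕ) : Type := PresentedMonoid (SingRel n)

/-- The singular generator `xᵢ` of `SBₙ⁺`. -/
def xPos (n : ℕ) (i : Fin (n - 1)) : SBPos n := PresentedMonoid.of _ (PosGen.sing i)

/-- The canonical homomorphism `Brₙ⁺ → SBₙ⁺`, `σᵢ ↦ σᵢ`. -/
def brToSing (n : ℕ) : BrPos n →* SBPos n :=
  PresentedMonoid.lift (fun i => PresentedMonoid.of (SingPosRel n) (PosGen.sigma i)) (by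
    intro a b h
    cases h with
    | comm i j h => exact PresentedMonoid.mk_eq_mk_of_rel (SingPosRel.sigma_comm i j h)
    | braid i j h => exact PresentedMonoid.mk_eq_mk_of_rel (SingPosRel.braid i j h))

/-- The canonical homomorphism `SBₙ⁺ → SBₙ`, `σᵢ ↦ σᵢ`, `xᵢ ↦ xᵢ`. -/
def posToSB (n : ℕ) : SBPos n →* SB n :=
  PresentedMonoid.lift
    (fun g => match g with
      | PosGen.sigma i => PresentedMonoid.of (SingRel n) (Gen.sigma i)
      | PosGen.sing i => PresentedMonoid.of (SingRel n) (Gen.sing i)) (by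
    intro a b h
    cases h with
    | sigma_comm i j h => exact PresentedMonoid.mk_eq_mk_of_rel (SingRel.sigma_comm i j h)
    | sing_comm i j h => exact PresentedMonoid.mk_eq_mk_of_rel (SingRel.sing_comm i j h)
    | sing_sigma_comm i j h =>
      exact PresentedMonoid.mk_eq_mk_of_rel (SingRel.sing_sigma_comm i j h)
    | braid i j h => exact PresentedMonoid.mk_eq_mk_of_rel (SingRel.braid i j h)
    | mixed_up i j h => exact PresentedMonoid.mk_eq_mk_of_rel (SingRel.mixed_up i j h)
    | mixed_down i j h => exact PresentedMonoid.mk_eq_mk_of_rel (SingRel.mixed_down i j h))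

/-- The homomorphism `Brₙ⁺ → (ℕ, +)` sending every `σᵢ` to `1`. -/
def lengthHom (n : ℕ) : BrPos n →* Multiplicative ℕ :=
  PresentedMonoid.lift (fun _ => Multiplicative.ofAdd 1) (by
    intro a b h
    cases h <;> rfl)

/-- The length of a positive braid: the number of letters of any positive word for it. -/
def len {n : ℕ} (A : BrPos n) : ℕ := Multiplicative.toAdd (lengthHom n A)

/-- The word `σ₁ ⋯ σₙ₋₁ σ₁ ⋯ σₙ₋₂ ⋯ σ₁ σ₂ σ₁`. -/
def garsideWord (n : ℕ) : List (Fin (n - 1)) :=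
  (List.finRange (n - 1)).reverse.flatMap fun t =>
    (List.finRange (n - 1)).filter fun k => k ≤ t

/-- Garside's fundamental element `Δ` of `Brₙ⁺`. -/
def garside (n : ℕ) : BrPos n :=
  ((garsideWord n).map (PresentedMonoid.of (BraidRel n))).prod

/-- `σᵢ` as a unit of `SBₙ`. -/
def sigmaUnit (n : ℕ) (i : Fin (n - 1)) : (SB n)ˣ where
  val := PresentedMonoid.of _ (Gen.sigma i)
  inv := PresentedMonoid.of _ (Gen.sigmaInv i)
  val_inv := PresentedMonoid.mk_eq_mk_of_rel (SingRel.mul_inv i)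
  inv_val := PresentedMonoid.mk_eq_mk_of_rel (SingRel.inv_mul i)

/-- `Δ` as a unit of `SBₙ`. -/
def garsideUnit (n : ℕ) : (SB n)ˣ := ((garsideWord n).map (sigmaUnit n)).prod

/-- Fragments of the fundamental word (positive permutation braids): the factors of `Δ`. -/
def IsFragment {n : ℕ} (A : BrPos n) : Prop := ∃ B C : BrPos n, garside n = B * A * C

/-- A block `S X`: `S` is given by its fragments, `X` by the indices of its letters `xⱼ`. -/
structure Block (n : ℕ) : Type where
  frags : List (BrPos n)
  sings : List (Fin (n - 1))

/-- The data of a form: an exponent of `Δ` and blocks `S₁ X₁, …, S_k X_k`. -/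
structure GreedyForm (n : ℕ) : Type where
  power : ℤ
  blocks : List (Block n)

/-- No superfluous empty parts: only `S₁` and `X_k` may be empty, and no block is empty. -/
def Reduced {n : ℕ} (bs : List (Block n)) : Prop :=
  (∀ b ∈ bs, b.frags ≠ [] ∨ b.sings ≠ []) ∧
    bs.IsChain fun b c => b.sings ≠ [] ∧ c.frags ≠ []

section Left

/-- `A` is a longest fragment among the left divisors of the positive braid `P`. -/
def IsLongestLeftFragment {n : ℕ} (A P : BrPos n) : Prop :=
  IsFragment A ∧ (∃ Q, P = A * Q) ∧
    ∀ B : BrPos n, IsFragment B → (∃ Q, P = B * Q) → len B ≤ len A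

/-- `A₁ ⋯ A_m` consists of successive longest non-trivial fragments, from the left. -/
def IsLeftGreedyBraid {n : ℕ} : List (BrPos n) → Prop
  | [] => True
  | A :: L => A ≠ 1 ∧ IsLongestLeftFragment A (A * L.prod) ∧ IsLeftGreedyBraid L

/-- `S` is a left divisor of `W` of maximal length among those that are positive braids. -/
def IsMaxLeftBraidDivisor {n : ℕ} (S : BrPos n) (W : SBPos n) : Prop :=
  (∃ T, W = brToSing n S * T) ∧
    ∀ (A : BrPos n) (V : SBPos n), W = brToSing n A * V → len A ≤ len S

/-- The product `x_{i₁} ⋯ x_{i_r}`. -/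
def leftSingProd {n : ℕ} (L : List (Fin (n - 1))) : SBPos n := (L.map (xPos n)).prod

/-- In the product `T = x_{i₁} ⋯ x_{i_r} R` every letter is the smallest `xⱼ` that divides what
has not yet been split off, and no positive braid can be split off between two letters. -/
def IsLeftSingOrdered {n : ℕ} : List (Fin (n - 1)) → SBPos n → Prop
  | [], _ => True
  | i :: L, R =>
      (∀ (j : Fin (n - 1)) (V : SBPos n), leftSingProd (i :: L) * R = xPos n j * V → i ≤ j) ∧
        (L ≠ [] → IsMaxLeftBraidDivisor 1 (leftSingProd L * R)) ∧ IsLeftSingOrdered L R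

/-- The product `S₁ X₁ ⋯ S_k X_k` in `SBₙ⁺`. -/
def leftProd {n : ℕ} : List (Block n) → SBPos n
  | [] => 1
  | b :: bs => brToSing n b.frags.prod * leftSingProd b.sings * leftProd bs

/-- Every `Sᵢ` is the left-greedy form of the maximal braid left divisor of
`Sᵢ Xᵢ ⋯ S_k X_k`, and every `Xᵢ` is ordered. -/
def IsLeftGreedyBlocks {n : ℕ} : List (Block n) → Prop
  | [] => True
  | b :: bs =>
      IsMaxLeftBraidDivisor b.frags.prod (leftProd (b :: bs)) ∧
        IsLeftGreedyBraid b.frags ∧ IsLeftSingOrdered b.sings (leftProd bs) ∧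
          IsLeftGreedyBlocks bs

/-- Left-greedy forms `Δ^t S₁ X₁ ⋯ S_k X_k`. -/
def GreedyForm.IsLeftGreedy {n : ℕ} (F : GreedyForm n) : Prop :=
  (¬ ∃ Z : SBPos n, leftProd F.blocks = brToSing n (garside n) * Z) ∧
    Reduced F.blocks ∧ IsLeftGreedyBlocks F.blocks

/-- The element `Δ^t S₁ X₁ ⋯ S_k X_k` of `SBₙ`. -/
def GreedyForm.leftValue {n : ℕ} (F : GreedyForm n) : SB n :=
  ((garsideUnit n ^ F.power : (SB n)ˣ) : SB n) * posToSB n (leftProd F.blocks)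

end Left

section Right

/-! The mirror images. All lists are kept in the order in which the factors are split off, that is,
from right to left. -/

/-- `A` is a longest fragment among the right divisors of the positive braid `P`. -/
def IsLongestRightFragment {n : ℕ} (A P : BrPos n) : Prop :=
  IsFragment A ∧ (∃ Q, P = Q * A) ∧
    ∀ B : BrPos n, IsFragment B → (∃ Q, P = Q * B) → len B ≤ len A

/-- The list `[A₁, …, A_m]` stands for the product `A_m ⋯ A₁`, which consists of successive longest
non-trivial fragments, from the right. -/
def IsRightGreedyBraid {n : ℕ} : List (BrPos n) → Prop
  | [] => True
  | A :: L => A ≠ 1 ∧ IsLongestRightFragment A (L.reverse.prod * A) ∧ IsRightGreedyBraid L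

/-- `S` is a right divisor of `W` of maximal length among those that are positive braids. -/
def IsMaxRightBraidDivisor {n : ℕ} (S : BrPos n) (W : SBPos n) : Prop :=
  (∃ T, W = T * brToSing n S) ∧
    ∀ (A : BrPos n) (V : SBPos n), W = V * brToSing n A → len A ≤ len S

/-- The product `x_{i_r} ⋯ x_{i₁}`. -/
def rightSingProd {n : ℕ} (L : List (Fin (n - 1))) : SBPos n := (L.reverse.map (xPos n)).prod

/-- In the product `T = R x_{i_r} ⋯ x_{i₁}` every letter, starting from `x_{i₁}`, is the smallest
`xⱼ` that divides on the right what has not yet been split off, and no positive braid can be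
split off between two letters. -/
def IsRightSingOrdered {n : ℕ} : List (Fin (n - 1)) → SBPos n → Prop
  | [], _ => True
  | i :: L, R =>
      (∀ (j : Fin (n - 1)) (V : SBPos n), R * rightSingProd (i :: L) = V * xPos n j → i ≤ j) ∧
        (L ≠ [] → IsMaxRightBraidDivisor 1 (R * rightSingProd L)) ∧ IsRightSingOrdered L R

/-- The product `X_k S_k ⋯ X₁ S₁` in `SBₙ⁺`. -/
def rightProd {n : ℕ} : List (Block n) → SBPos n
  | [] => 1
  | b :: bs => rightProd bs * rightSingProd b.sings * brToSing n b.frags.reverse.prod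

/-- Every `Sᵢ` is the right-greedy form of the maximal braid right divisor of
`X_k S_k ⋯ Xᵢ Sᵢ`, and every `Xᵢ` is ordered. -/
def IsRightGreedyBlocks {n : ℕ} : List (Block n) → Prop
  | [] => True
  | b :: bs =>
      IsMaxRightBraidDivisor b.frags.reverse.prod (rightProd (b :: bs)) ∧
        IsRightGreedyBraid b.frags ∧ IsRightSingOrdered b.sings (rightProd bs) ∧
          IsRightGreedyBlocks bs

/-- Right-greedy forms `X_k S_k ⋯ X₁ S₁ Δ^t`. -/
def GreedyForm.IsRightGreedy {n : ℕ} (F : GreedyForm n) : Prop :=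
  (¬ ∃ Z : SBPos n, rightProd F.blocks = Z * brToSing n (garside n)) ∧
    Reduced F.blocks ∧ IsRightGreedyBlocks F.blocks

/-- The element `X_k S_k ⋯ X₁ S₁ Δ^t` of `SBₙ`. -/
def GreedyForm.rightValue {n : ℕ} (F : GreedyForm n) : SB n :=
  posToSB n (rightProd F.blocks) * ((garsideUnit n ^ F.power : (SB n)ˣ) : SB n)

end Right

end SingularBraid

/-! The core is a statement about the positive monoid $SB_n^+$, `linked_of_mul_eq`: if two
generators have a common right multiple, every such multiple passes through the one read off from a
defining relation (and $x_i$, $x_{i+1}$ have none). As in Garside's treatment of braids, this is an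
induction on length. Along a chain of relations only transitivity is not formal, and it reduces to a
cube condition on three generators. Word reversing decides that condition, and only the mutual
position of three nodes matters, so finitely many computations suffice.

It follows that $SB_n^+$ is cancellative, and that two positive braids dividing the same element
have a common multiple dividing it (`exists_common_multiple`). An element therefore has only one
braid left divisor of maximal length, and a positive braid only one longest left fragment.

Conjugation by $\Delta$ permutes the $\sigma_i$ and the $x_i$, and every $\sigma_i$ divides
$\Delta$. The powers of $\Delta$ thus form an Ore set; in the monoid of fractions the $\sigma_i$ are
invertible, so the embedding of $SB_n^+$ into it factors through $SB_n$ and `posToSB_injective`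
follows. Multiplication by a power of $\Delta$ makes any singular braid positive, which gives a
unique expression $\Delta^t W$ with $W$ positive and not divisible by $\Delta$
(`existsUnique_garside_zpow_mul`).

It remains to decompose $W$: the maximal braid divisor is forced, then the smallest singular letter
is split off repeatedly until a braid divides the remainder or nothing is left, and the process
restarts. Cancellation makes each step deterministic. The right-handed statement is transported
along the anti-automorphism that reads words backwards, which fixes $\Delta$. -/

namespace SingularBraid

/-! ### Word reversing and the cube condition -/

section Reversing

variable {α : Type*}

/-- Word reversing for a complement `c`, with bounded recursion depth. The value `none` means that
the bound was too small, `some none` that the two words have no common right multiple, and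
`some (some (p, q))` that `u p = v q` is their least common right multiple. -/
def reversing (c : α → α → Option (List α)) :
    ℕ → List α → List α → Option (Option (List α × List α))
  | 0, _, _ => none
  | _ + 1, [], v => some (some (v, []))
  | _ + 1, a :: u, [] => some (some ([], a :: u))
  | k + 1, a :: u, b :: v =>
    match c a b, c b a with
    | some s, some t =>
      match reversing c k u s, reversing c k v t with
      | some (some (p₁, q₁)), some (some (p₂, q₂)) =>
        match reversing c k q₁ q₂ with
        | some (some (p₃, q₃)) => some (some (p₁ ++ p₃, p₂ ++ q₃))
        | some none => some none
        | none => none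
      | some none, _ => some none
      | _, some none => some none
      | _, _ => none
    | _, _ => some none

/-- The cube condition for the letters `a`, `b` above the letter `d`, tested by reversing. -/
def cubeTest (c : α → α → Option (List α)) (k : ℕ) (a b d : α) : Bool :=
  match c a d, c d a, c d b, c b d with
  | some ad, some da, some db, some bd =>
    match reversing c k da db with
    | none => false
    | some none => true
    | some (some (p, q)) =>
      match c a b, c b a with
      | some s, some t =>
        -- Both `a * ad * p` and `b * bd * q` spell the same common multiple of `a`, `b`, `d`. It
        -- has to factor through the common multiple of `a` and `b`, with the same cofactor `z = z'`
        -- on either side.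
        match reversing c k s (ad ++ p), reversing c k t (bd ++ q) with
        | some (some (z, [])), some (some (z', [])) =>
          match reversing c k z z' with
          | some (some ([], [])) => true
          | _ => false
        | _, _ => false
      | _, _ => false
  | _, _, _, _ => true

end Reversing

/-- The mutual position of two nodes of a Coxeter graph with labels `2` and `3`. -/
inductive Proximity : Type
  | same
  | adj
  | far

/-- The complement of the positive singular presentation attached to a Coxeter graph. The pair
`(true, i)` stands for `σᵢ` and `(false, i)` for `xᵢ`. -/
def complement {ι : Type*} (prox : ι → ι → Proximity) :
    Bool × ι → Bool × ι → Option (List (Bool × ι))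
  | (k, i), (l, j) =>
    match prox i j, k, l with
    | .same, true, true => some []
    | .same, false, false => some []
    | .same, true, false => some [(false, j)]
    | .same, false, true => some [(true, j)]
    | .far, _, l => some [(l, j)]
    | .adj, true, l => some [(true, j), (l, i)]
    | .adj, false, true => some [(true, j), (true, i)]
    | .adj, false, false => none

/-- The table of mutual positions of three nodes. -/
def proximityTable (r s t : Proximity) : Fin 3 → Fin 3 → Proximity
  | 0, 1 => r
  | 1, 0 => r
  | 0, 2 => s
  | 2, 0 => s
  | 1, 2 => t
  | 2, 1 => t
  | _, _ => .same

/-! ### Soundness and completeness of reversing -/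

section Reversing

variable {α M : Type*} [Monoid M]

/-- The elements `g a * W` and `g b * V` agree because both are multiples of the common multiple
of `g a` and `g b` that the complement `c` provides. -/
def Linked (c : α → α → Option (List α)) (g : α → M) (a : α) (W : M) (b : α) (V : M) : Prop :=
  ∃ s t U, c a b = some s ∧ c b a = some t ∧ W = (s.map g).prod * U ∧ V = (t.map g).prod * U

theorem Linked.symm {c : α → α → Option (List α)} {g : α → M} {a b : α} {W V : M}
    (h : Linked c g a W b V) : Linked c g b V a W := by
  obtain ⟨s, t, U, h₁, h₂, h₃, h₄⟩ := h
  exact ⟨t, s, U, h₂, h₁, h₄, h₃⟩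

theorem Linked.mul {c : α → α → Option (List α)} {g : α → M} {a b : α} {W V : M}
    (h : Linked c g a W b V) (X : M) : Linked c g a (W * X) b (V * X) := by
  obtain ⟨s, t, U, h₁, h₂, rfl, rfl⟩ := h
  exact ⟨s, t, U * X, h₁, h₂, mul_assoc _ _ _, mul_assoc _ _ _⟩

variable {c : α → α → Option (List α)} {g : α → M}

/-- Every elementary cell of the reversing diagram commutes by `hrel`, hence so does the whole
rectangle pasted from them. -/
theorem reversing_eq
    (hrel : ∀ a b s t, c a b = some s → c b a = some t →
      g a * (s.map g).prod = g b * (t.map g).prod) :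
    ∀ (k : ℕ) (u v p q : List α), reversing c k u v = some (some (p, q)) →
      (u.map g).prod * (p.map g).prod = (v.map g).prod * (q.map g).prod := by
  intro k
  induction k with
  | zero => intro u v p q h; simp [reversing] at h
  | succ k ih =>
    intro u v p q h
    match u, v with
    | [], v =>
      simp only [reversing, Option.some.injEq, Prod.mk.injEq] at h
      obtain ⟨rfl, rfl⟩ := h
      simp
    | a :: u, [] =>
      simp only [reversing, Option.some.injEq, Prod.mk.injEq] at h
      obtain ⟨rfl, rfl⟩ := h
      simp
    | a :: u, b :: v =>
      rw [reversing] at h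
      split at h
      · rename_i s t hs ht
        split at h
        · rename_i p₁ q₁ p₂ q₂ h₁ h₂
          split at h
          · rename_i p₃ q₃ h₃
            simp only [Option.some.injEq, Prod.mk.injEq] at h
            obtain ⟨rfl, rfl⟩ := h
            have e₁ := ih _ _ _ _ h₁
            have e₂ := ih _ _ _ _ h₂
            have e₃ := ih _ _ _ _ h₃
            have e := hrel a b s t hs ht
            simp only [List.map_cons, List.prod_cons, List.map_append, List.prod_append]
            calc _ = g a * (((u.map g).prod * (p₁.map g).prod) * (p₃.map g).prod) := by
                  simp only [mul_assoc]
              _ = (g a * (s.map g).prod) * ((q₁.map g).prod * (p₃.map g).prod) := by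
                  rw [e₁]; simp only [mul_assoc]
              _ = g b * (((t.map g).prod * (q₂.map g).prod) * (q₃.map g).prod) := by
                  rw [e, e₃]; simp only [mul_assoc]
              _ = _ := by rw [← e₂]; simp only [mul_assoc]
          · simp at h
          · simp at h
        · simp at h
        · simp at h
        · simp at h
      · simp at h

/-- A given common multiple is pushed through the reversing diagram: `hN` factors it through the
first cell, and the three remaining rectangles again carry common multiples of length at most `N`.
Hence the answer "no common multiple" is impossible, and the computed multiple divides the given
one. -/
theorem reversing_complete (ℓ : M → ℕ) (hℓ : ∀ x y, ℓ (x * y) = ℓ x + ℓ y)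
    (hg : ∀ a, ℓ (g a) = 1) (N : ℕ)
    (hN : ∀ a b W V, ℓ W < N → g a * W = g b * V → Linked c g a W b V) :
    ∀ (k : ℕ) (u v : List α) r, reversing c k u v = some r → ∀ U V : M,
      ℓ ((u.map g).prod * U) ≤ N → (u.map g).prod * U = (v.map g).prod * V →
      ∃ p q Z, r = some (p, q) ∧ U = (p.map g).prod * Z ∧ V = (q.map g).prod * Z := by
  intro k
  induction k with
  | zero => intro u v r h; simp [reversing] at h
  | succ k ih =>
    intro u v r h U V hlen heq
    match u, v with
    | [], v =>
      simp only [reversing, Option.some.injEq] at h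
      subst h
      exact ⟨v, [], V, rfl, by simpa using heq, by simp⟩
    | a :: u, [] =>
      simp only [reversing, Option.some.injEq] at h
      subst h
      exact ⟨[], a :: u, U, rfl, by simp, by simpa using heq.symm⟩
    | a :: u, b :: v =>
      simp only [List.map_cons, List.prod_cons, mul_assoc] at heq hlen
      have hlen' := congrArg ℓ heq
      rw [hℓ, hg] at hlen
      rw [hℓ, hℓ (g b), hg, hg] at hlen'
      obtain ⟨s, t, Z, hs, ht, hW, hV⟩ := hN _ _ _ _ (by omega) heq
      rw [reversing] at h
      simp only [hs, ht] at h
      split at h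
      · rename_i p₁ q₁ p₂ q₂ h₁ h₂
        obtain ⟨p, q, Z₁, e, hU, hZ⟩ := ih _ _ _ h₁ _ _ (by omega) hW
        obtain ⟨rfl, rfl⟩ : p₁ = p ∧ q₁ = q := by simpa using e
        obtain ⟨p, q, Z₂, e, hU', hZ'⟩ := ih _ _ _ h₂ _ _ (by omega) hV
        obtain ⟨rfl, rfl⟩ : p₂ = p ∧ q₂ = q := by simpa using e
        have hq : ℓ ((q₁.map g).prod * Z₁) ≤ N := by
          rw [← hZ]
          have := congrArg ℓ hW
          rw [hℓ _ Z] at this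
          omega
        have key := ih q₁ q₂
        split at h
        · rename_i p₃ q₃ h₃
          obtain ⟨p, q, Z₃, e, hU₃, hZ₃⟩ := key _ h₃ _ _ hq (hZ.symm.trans hZ')
          obtain ⟨rfl, rfl⟩ : p₃ = p ∧ q₃ = q := by simpa using e
          simp only [Option.some.injEq] at h
          refine ⟨_, _, Z₃, h.symm, ?_, ?_⟩
          · rw [hU, hU₃]; simp [mul_assoc]
          · rw [hU', hZ₃]; simp [mul_assoc]
        · rename_i h₃
          obtain ⟨p, q, Z₃, e, -⟩ := key _ h₃ _ _ hq (hZ.symm.trans hZ')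
          simp at e
        · simp at h
      · rename_i h₁
        obtain ⟨p, q, Z₁, e, -⟩ := ih _ _ _ h₁ _ _ (by omega) hW
        simp at e
      · rename_i h₂ _
        obtain ⟨p, q, Z₁, e, -⟩ := ih _ _ _ h₂ _ _ (by omega) hV
        simp at e
      · simp at h

/-- The local cube condition makes `Linked` transitive. -/
theorem Linked.trans_of_cubeTest (ℓ : M → ℕ) (hℓ : ∀ x y, ℓ (x * y) = ℓ x + ℓ y)
    (hg : ∀ a, ℓ (g a) = 1) (N : ℕ)
    (hN : ∀ a b W V, ℓ W < N → g a * W = g b * V → Linked c g a W b V)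
    (hrel : ∀ a b s t, c a b = some s → c b a = some t →
      g a * (s.map g).prod = g b * (t.map g).prod)
    {k : ℕ} {a b d : α} (htest : cubeTest c k a b d = true) {W Y V : M} (hY : ℓ Y ≤ N)
    (h₁ : Linked c g a W d Y) (h₂ : Linked c g d Y b V) : Linked c g a W b V := by
  obtain ⟨ad, da, U, had, hda, rfl, rfl⟩ := h₁
  obtain ⟨db, bd, U', hdb, hbd, e, rfl⟩ := h₂
  have comp := reversing_complete (c := c) (g := g) ℓ hℓ hg N hN
  have sound := reversing_eq (c := c) (g := g) hrel
  rw [cubeTest] at htest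
  simp only [had, hda, hdb, hbd] at htest
  split at htest
  · simp at htest
  · rename_i h
    -- The element `Y` is itself a common multiple of `da` and `db`.
    obtain ⟨p, q, Z, e', -⟩ := comp _ _ _ _ h _ _ hY e
    simp at e'
  · rename_i p q h
    obtain ⟨p', q', Z, e', hU, hU'⟩ := comp _ _ _ _ h _ _ hY e
    obtain ⟨rfl, rfl⟩ : p = p' ∧ q = q' := by simpa using e'
    split at htest
    · rename_i s t hs ht
      split at htest
      · rename_i z z' hz hz'
        split at htest
        · rename_i hzz
          have e₁ := sound _ _ _ _ _ hz
          have e₂ := sound _ _ _ _ _ hz'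
          have e₃ := sound _ _ _ _ _ hzz
          simp only [List.map_append, List.prod_append, List.map_nil, List.prod_nil, mul_one]
            at e₁ e₂ e₃
          refine ⟨s, t, (z.map g).prod * Z, hs, ht, ?_, ?_⟩
          · rw [hU, ← mul_assoc, ← mul_assoc, e₁]
          · rw [hU', ← mul_assoc, ← mul_assoc, e₃, e₂]
        · simp at htest
      · simp at htest
    · simp at htest

end Reversing

/-! ### Reduction to three nodes of the Coxeter graph -/

theorem complement_map {ι κ : Type*} (prox : ι → ι → Proximity) (e : κ → ι) (a b : Bool × κ) :
    complement prox (Prod.map id e a) (Prod.map id e b) =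
      (complement (fun p q => prox (e p) (e q)) a b).map (List.map (Prod.map id e)) := by
  obtain ⟨k, i⟩ := a
  obtain ⟨l, j⟩ := b
  simp only [complement, Prod.map, id]
  cases prox (e i) (e j) <;> cases k <;> cases l <;> rfl

theorem linked_map_iff {ι κ M : Type*} [Monoid M] (prox : ι → ι → Proximity) (e : κ → ι)
    (g : Bool × ι → M) (a b : Bool × κ) (W V : M) :
    Linked (complement prox) g (Prod.map id e a) W (Prod.map id e b) V ↔
      Linked (complement fun p q => prox (e p) (e q)) (fun x => g (Prod.map id e x)) a W b V := by
  simp only [Linked, complement_map, Option.map_eq_some_iff]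
  constructor
  · rintro ⟨_, _, U, ⟨s, hs, rfl⟩, ⟨t, ht, rfl⟩, h₁, h₂⟩
    exact ⟨s, t, U, hs, ht, by rw [h₁, List.map_map]; rfl, by rw [h₂, List.map_map]; rfl⟩
  · rintro ⟨s, t, U, hs, ht, h₁, h₂⟩
    exact ⟨_, _, U, ⟨s, hs, rfl⟩, ⟨t, ht, rfl⟩, by rw [h₁, List.map_map]; rfl,
      by rw [h₂, List.map_map]; rfl⟩

/-- Two nodes of the linear Coxeter graph. -/
def nodeProximity {m : ℕ} (i j : Fin m) : Proximity :=
  if i = j then .same else if |(i : ℤ) - (j : ℤ)| = 1 then .adj else .far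

theorem nodeProximity_comm {m : ℕ} (i j : Fin m) : nodeProximity i j = nodeProximity j i := by
  simp only [nodeProximity, eq_comm (a := i), abs_sub_comm (i : ℤ)]

/-- Positions that cannot occur on a line, such as three pairwise adjacent nodes, are excluded by
arithmetic. In every other case the test is evaluated, and recursion depth `10` suffices. -/
theorem cubeTest_proximityTable {m : ℕ} (i j k : Fin m) (x y z : Bool) :
    cubeTest (complement (proximityTable (nodeProximity i j) (nodeProximity i k)
      (nodeProximity j k))) 10 (x, 0) (y, 1) (z, 2) = true := by
  unfold nodeProximity
  split_ifs <;> first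
    | (exfalso; simp only [Fin.ext_iff, abs_eq (zero_le_one' ℤ)] at *; omega)
    | (cases x <;> cases y <;> cases z <;> rfl)

theorem nodeProximity_eq_proximityTable {m : ℕ} (i j k : Fin m) :
    (fun p q => nodeProximity (![i, j, k] p) (![i, j, k] q)) =
      proximityTable (nodeProximity i j) (nodeProximity i k) (nodeProximity j k) := by
  have hs (a : Fin m) : nodeProximity a a = .same := by simp [nodeProximity]
  funext p q
  fin_cases p <;> fin_cases q <;>
    simp [proximityTable, hs, nodeProximity_comm j i, nodeProximity_comm k i,
      nodeProximity_comm k j]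

/-! ### Length, letters and relations of the positive singular braid monoid -/

variable {n : ℕ}

/-- The homomorphism `SBₙ⁺ → (ℕ, +)` sending every generator to `1`. -/
def singLengthHom (n : ℕ) : SBPos n →* Multiplicative ℕ :=
  PresentedMonoid.lift (fun _ => Multiplicative.ofAdd 1) (by
    intro a b h
    cases h <;> rfl)

/-- The length of a positive singular braid. -/
def singLen (W : SBPos n) : ℕ := Multiplicative.toAdd (singLengthHom n W)

@[simp] theorem singLen_one : singLen (1 : SBPos n) = 0 := by simp [singLen]

@[simp] theorem singLen_mul (W V : SBPos n) : singLen (W * V) = singLen W + singLen V := by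
  simp [singLen]

@[simp] theorem singLen_xPos (i : Fin (n - 1)) : singLen (xPos n i) = 1 := rfl

/-- The generator `σᵢ` of `SBₙ⁺`. -/
def sPos (n : ℕ) (i : Fin (n - 1)) : SBPos n := PresentedMonoid.of _ (PosGen.sigma i)

@[simp] theorem singLen_sPos (i : Fin (n - 1)) : singLen (sPos n i) = 1 := rfl

/-- The generators of `SBₙ⁺` as a family: `(true, i)` stands for `σᵢ`, `(false, i)` for `xᵢ`. -/
def posLetter (n : ℕ) : Bool × Fin (n - 1) → SBPos n
  | (true, i) => sPos n i
  | (false, i) => xPos n i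

@[simp] theorem singLen_posLetter (a : Bool × Fin (n - 1)) : singLen (posLetter n a) = 1 := by
  obtain ⟨k, i⟩ := a
  cases k <;> rfl

/-- The kind and the node of a generator. -/
def PosGen.node : PosGen n → Bool × Fin (n - 1)
  | .sigma i => (true, i)
  | .sing i => (false, i)

@[simp] theorem posLetter_node (x : PosGen n) :
    posLetter n x.node = PresentedMonoid.of (SingPosRel n) x := by
  cases x <;> rfl

theorem freeMonoid_cons_inj {α : Type*} {x y : α} {u v : FreeMonoid α}
    (h : FreeMonoid.of x * u = FreeMonoid.of y * v) : x = y ∧ u = v :=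
  List.cons.inj h

theorem eq_one_of_singLen_eq_zero {W : SBPos n} (h : singLen W = 0) : W = 1 := by
  obtain ⟨w, rfl⟩ := PresentedMonoid.surjective_mk W
  cases w using FreeMonoid.casesOn with
  | one => rfl
  | of_mul x u =>
    rw [map_mul, singLen_mul] at h
    have : singLen (PresentedMonoid.mk (SingPosRel n) (FreeMonoid.of x)) = 1 := rfl
    omega

/-- Structural induction on positive singular braids. -/
theorem SBPos.induction_left {p : SBPos n → Prop} (one : p 1)
    (mul : ∀ a W, p W → p (posLetter n a * W)) (W : SBPos n) : p W := by
  obtain ⟨w, rfl⟩ := PresentedMonoid.surjective_mk W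
  induction w using FreeMonoid.recOn with
  | one => exact one
  | of_mul x u hu =>
    rw [map_mul]
    have := mul x.node _ hu
    rwa [posLetter_node] at this

section Relations

theorem sPos_comm {i j : Fin (n - 1)} (h : 1 < |(i : ℤ) - (j : ℤ)|) :
    sPos n i * sPos n j = sPos n j * sPos n i :=
  PresentedMonoid.mk_eq_mk_of_rel (SingPosRel.sigma_comm i j h)

theorem xPos_comm {i j : Fin (n - 1)} (h : 1 < |(i : ℤ) - (j : ℤ)|) :
    xPos n i * xPos n j = xPos n j * xPos n i :=
  PresentedMonoid.mk_eq_mk_of_rel (SingPosRel.sing_comm i j h)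

theorem xPos_mul_sPos {i j : Fin (n - 1)} (h : |(i : ℤ) - (j : ℤ)| ≠ 1) :
    xPos n i * sPos n j = sPos n j * xPos n i :=
  PresentedMonoid.mk_eq_mk_of_rel (SingPosRel.sing_sigma_comm i j h)

theorem sPos_braid {i j : Fin (n - 1)} (h : |(i : ℤ) - (j : ℤ)| = 1) :
    sPos n i * (sPos n j * sPos n i) = sPos n j * (sPos n i * sPos n j) := by
  rw [← mul_assoc, ← mul_assoc]
  rcases (abs_eq zero_le_one).1 h with h | h
  · exact (PresentedMonoid.mk_eq_mk_of_rel (SingPosRel.braid j i (by omega))).symm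
  · exact PresentedMonoid.mk_eq_mk_of_rel (SingPosRel.braid i j (by omega))

theorem sPos_mul_sPos_mul_xPos {i j : Fin (n - 1)} (h : |(i : ℤ) - (j : ℤ)| = 1) :
    sPos n i * (sPos n j * xPos n i) = xPos n j * (sPos n i * sPos n j) := by
  rw [← mul_assoc, ← mul_assoc]
  rcases (abs_eq zero_le_one).1 h with h | h
  · exact PresentedMonoid.mk_eq_mk_of_rel (SingPosRel.mixed_down j i (by omega))
  · exact PresentedMonoid.mk_eq_mk_of_rel (SingPosRel.mixed_up i j (by omega))

end Relations

/-! ### Common right multiples of two generators -/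

theorem nodeProximity_eq_same {m : ℕ} {i j : Fin m} (h : nodeProximity i j = .same) : i = j := by
  unfold nodeProximity at h
  split_ifs at h
  assumption

theorem nodeProximity_eq_adj {m : ℕ} {i j : Fin m} (h : nodeProximity i j = .adj) :
    |(i : ℤ) - (j : ℤ)| = 1 := by
  unfold nodeProximity at h
  split_ifs at h
  assumption

theorem nodeProximity_eq_far {m : ℕ} {i j : Fin m} (h : nodeProximity i j = .far) :
    1 < |(i : ℤ) - (j : ℤ)| := by
  unfold nodeProximity at h
  split_ifs at h with h₁ h₂
  have := abs_pos.2 (sub_ne_zero.2 fun e : (i : ℤ) = j => h₁ (Fin.ext (by omega)))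
  omega

theorem nodeProximity_of_adj {m : ℕ} {i j : Fin m} (h : |(i : ℤ) - (j : ℤ)| = 1) :
    nodeProximity i j = .adj := by
  have : i ≠ j := by rintro rfl; simp at h
  simp [nodeProximity, this, h]

theorem nodeProximity_of_far {m : ℕ} {i j : Fin m} (h : 1 < |(i : ℤ) - (j : ℤ)|) :
    nodeProximity i j = .far := by
  have : i ≠ j := by rintro rfl; simp at h
  simp [nodeProximity, this, h.ne']

theorem posLetter_mul_complement (a b : Bool × Fin (n - 1)) (s t : List (Bool × Fin (n - 1)))
    (hs : complement nodeProximity a b = some s) (ht : complement nodeProximity b a = some t) :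
    posLetter n a * (s.map (posLetter n)).prod = posLetter n b * (t.map (posLetter n)).prod := by
  obtain ⟨k, i⟩ := a
  obtain ⟨l, j⟩ := b
  simp only [complement, nodeProximity_comm j i] at hs ht
  cases h : nodeProximity i j with
  | same =>
    obtain rfl := nodeProximity_eq_same h
    rw [h] at hs ht
    cases k <;> cases l <;> cases hs <;> cases ht <;>
      simp [posLetter, xPos_mul_sPos (i := i) (j := i) (by simp)]
  | far =>
    have h' := nodeProximity_eq_far h
    rw [h] at hs ht
    cases hs
    cases ht
    rw [abs_sub_comm] at h'
    cases k <;> cases l <;>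
      simp [posLetter, xPos_comm h', sPos_comm h', xPos_mul_sPos h'.ne',
        xPos_mul_sPos (abs_sub_comm (j : ℤ) i ▸ h'.ne')]
  | adj =>
    have h' := nodeProximity_eq_adj h
    rw [h] at hs ht
    rw [abs_sub_comm] at h'
    cases k <;> cases l <;> cases hs <;> cases ht <;>
      simp [posLetter, sPos_braid h', sPos_mul_sPos_mul_xPos h',
        sPos_mul_sPos_mul_xPos (abs_sub_comm (j : ℤ) i ▸ h')]

/-- The presentation is complemented: each defining relation is exactly the one that the complement
attaches to its two initial letters. -/
theorem linked_of_rel {x y : PosGen n} {u v : FreeMonoid (PosGen n)}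
    (h : SingPosRel n (.of x * u) (.of y * v)) :
    Linked (complement nodeProximity) (posLetter n) x.node (PresentedMonoid.mk _ u)
      y.node (PresentedMonoid.mk _ v) := by
  generalize hw : FreeMonoid.of x * u = w at h
  generalize hw' : FreeMonoid.of y * v = w' at h
  have key (x' : PosGen n) (u' : FreeMonoid (PosGen n)) (y' : PosGen n)
      (v' : FreeMonoid (PosGen n)) (hx : FreeMonoid.of x * u = FreeMonoid.of x' * u')
      (hy : FreeMonoid.of y * v = FreeMonoid.of y' * v')
      (hs : complement nodeProximity x'.node y'.node = some (u'.toList.map PosGen.node))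
      (ht : complement nodeProximity y'.node x'.node = some (v'.toList.map PosGen.node)) :
      Linked (complement nodeProximity) (posLetter n) x.node (PresentedMonoid.mk _ u)
        y.node (PresentedMonoid.mk _ v) := by
    obtain ⟨rfl, rfl⟩ := freeMonoid_cons_inj hx
    obtain ⟨rfl, rfl⟩ := freeMonoid_cons_inj hy
    have hmk (z : FreeMonoid (PosGen n)) : PresentedMonoid.mk (SingPosRel n) z =
        ((z.toList.map PosGen.node).map (posLetter n)).prod := by
      induction z using FreeMonoid.recOn with
      | one => rfl
      | of_mul a z ih => simp [ih, PresentedMonoid.of]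
    exact ⟨_, _, 1, hs, ht, by rw [hmk, mul_one], by rw [hmk, mul_one]⟩
  cases h with
  | sigma_comm i j h =>
    refine key _ _ _ _ hw hw' ?_ ?_ <;>
      simp [complement, PosGen.node, nodeProximity_of_far h,
        nodeProximity_of_far (abs_sub_comm (i : ℤ) j ▸ h)]
  | sing_comm i j h =>
    refine key _ _ _ _ hw hw' ?_ ?_ <;>
      simp [complement, PosGen.node, nodeProximity_of_far h,
        nodeProximity_of_far (abs_sub_comm (i : ℤ) j ▸ h)]
  | sing_sigma_comm i j h =>
    have hc := nodeProximity_comm i j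
    cases e : nodeProximity i j with
    | adj => exact absurd (nodeProximity_eq_adj e) h
    | _ =>
      rw [e] at hc
      refine key _ _ _ _ hw hw' ?_ ?_ <;> simp [complement, PosGen.node, e, ← hc]
  | braid i j h =>
    have h' : |(i : ℤ) - (j : ℤ)| = 1 := by rw [h]; simp
    refine key _ _ _ _ (hw.trans (mul_assoc _ _ _)) (hw'.trans (mul_assoc _ _ _)) ?_ ?_ <;>
      simp [complement, PosGen.node, nodeProximity_of_adj h',
        nodeProximity_of_adj (abs_sub_comm (i : ℤ) j ▸ h')]
  | mixed_up i j h =>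
    have h' : |(i : ℤ) - (j : ℤ)| = 1 := by rw [h]; simp
    refine key _ _ _ _ (hw.trans (mul_assoc _ _ _)) (hw'.trans (mul_assoc _ _ _)) ?_ ?_ <;>
      simp [complement, PosGen.node, nodeProximity_of_adj h',
        nodeProximity_of_adj (abs_sub_comm (i : ℤ) j ▸ h')]
  | mixed_down i j h =>
    have h' : |(i : ℤ) - (j : ℤ)| = 1 := by rw [h]; simp
    refine key _ _ _ _ (hw.trans (mul_assoc _ _ _)) (hw'.trans (mul_assoc _ _ _)) ?_ ?_ <;>
      simp [complement, PosGen.node, nodeProximity_of_adj h',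
        nodeProximity_of_adj (abs_sub_comm (i : ℤ) j ▸ h')]

/-- Only the nodes `i`, `j`, `k` of the three letters are involved, so everything is pulled back
along `![i, j, k]` to `Fin 3`, where the cube condition has been computed. -/
theorem linked_trans_of_lt (N : ℕ)
    (hN : ∀ a b W V, singLen W < N → posLetter n a * W = posLetter n b * V →
      Linked (complement nodeProximity) (posLetter n) a W b V)
    {a b d : Bool × Fin (n - 1)} {W Y V : SBPos n} (hY : singLen Y ≤ N)
    (h₁ : Linked (complement nodeProximity) (posLetter n) a W d Y)
    (h₂ : Linked (complement nodeProximity) (posLetter n) d Y b V) :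
    Linked (complement nodeProximity) (posLetter n) a W b V := by
  obtain ⟨x, i⟩ := a
  obtain ⟨y, j⟩ := b
  obtain ⟨z, k⟩ := d
  have ha : ((x, i) : Bool × Fin (n - 1)) = Prod.map id ![i, j, k] (x, 0) := rfl
  have hb : ((y, j) : Bool × Fin (n - 1)) = Prod.map id ![i, j, k] (y, 1) := rfl
  have hd : ((z, k) : Bool × Fin (n - 1)) = Prod.map id ![i, j, k] (z, 2) := rfl
  rw [ha, hd, linked_map_iff] at h₁
  rw [hd, hb, linked_map_iff] at h₂
  rw [ha, hb, linked_map_iff]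
  refine Linked.trans_of_cubeTest singLen singLen_mul (fun a => singLen_posLetter _) N ?_ ?_
    (k := 10) ?_ hY h₁ h₂
  · intro a b W V hW h
    rw [← linked_map_iff]
    exact hN _ _ _ _ hW h
  · intro a b s t hs ht
    have := posLetter_mul_complement (n := n) (Prod.map id ![i, j, k] a)
      (Prod.map id ![i, j, k] b) (s.map (Prod.map id ![i, j, k]))
      (t.map (Prod.map id ![i, j, k])) (by rw [complement_map, hs]; rfl)
      (by rw [complement_map, ht]; rfl)
    rw [List.map_map, List.map_map] at this
    exact this
  · rw [nodeProximity_eq_proximityTable]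
    exact cubeTest_proximityTable i j k x y z

/-- Induction on the generation of the congruence. Only transitivity uses the cube condition; since
the relations preserve length, the intermediate word is non-empty and its tail satisfies the same
bound. -/
theorem linked_of_conGen (N : ℕ)
    (hN : ∀ a b W V, singLen W < N → posLetter n a * W = posLetter n b * V →
      Linked (complement nodeProximity) (posLetter n) a W b V)
    (w w' : FreeMonoid (PosGen n)) (h : ConGen.Rel (SingPosRel n) w w') :
    ∀ x u y v, w = .of x * u → w' = .of y * v →
      singLen (PresentedMonoid.mk (SingPosRel n) u) ≤ N →
      Linked (complement nodeProximity) (posLetter n) x.node (PresentedMonoid.mk _ u)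
        y.node (PresentedMonoid.mk _ v) := by
  have hlen {w w' : FreeMonoid (PosGen n)} (h : ConGen.Rel (SingPosRel n) w w') :
      singLen (PresentedMonoid.mk (SingPosRel n) w) =
        singLen (PresentedMonoid.mk (SingPosRel n) w') :=
    congrArg singLen (PresentedMonoid.mk_eq_mk_iff.2 h)
  have hcons (x : PosGen n) (u : FreeMonoid (PosGen n)) :
      singLen (PresentedMonoid.mk (SingPosRel n) (.of x * u)) =
        1 + singLen (PresentedMonoid.mk (SingPosRel n) u) := by
    rw [map_mul, singLen_mul]; rfl
  have hnil : singLen (PresentedMonoid.mk (SingPosRel n) 1) = 0 := rfl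
  induction h with
  | of w w' h =>
    rintro x u y v rfl rfl -
    exact linked_of_rel h
  | refl w =>
    rintro x u y v rfl h -
    obtain ⟨rfl, rfl⟩ := freeMonoid_cons_inj h
    refine ⟨[], [], PresentedMonoid.mk _ u, ?_, ?_, by simp, by simp⟩ <;>
      cases x <;> simp [complement, PosGen.node, nodeProximity]
  | @symm w w' h ih =>
    rintro x u y v rfl rfl hu
    have := hlen h
    rw [hcons, hcons] at this
    exact (ih y v x u rfl rfl (by omega)).symm
  | @trans w w' w'' h₁ h₂ ih₁ ih₂ =>
    rintro x u y v rfl rfl hu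
    have := hlen h₁
    cases w' using FreeMonoid.casesOn with
    | one => rw [hcons] at this; omega
    | of_mul z t =>
      rw [hcons, hcons] at this
      exact linked_trans_of_lt N hN (by omega) (ih₁ x u z t rfl rfl hu)
        (ih₂ z t y v rfl rfl (by omega))
  | @mul w₁ w₁' w₂ w₂' h₁ h₂ ih₁ ih₂ =>
    intro x u y v hx hy hu
    have := hlen h₁
    -- The first letter comes from the left factor unless that factor is empty; by length, `w₁` and
    -- `w₁'` are empty together.
    cases w₁ using FreeMonoid.casesOn with
    | one =>
      cases w₁' using FreeMonoid.casesOn with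
      | one => exact ih₂ x u y v (by simpa using hx) (by simpa using hy) hu
      | of_mul z t => rw [hcons] at this; omega
    | of_mul z t =>
      cases w₁' using FreeMonoid.casesOn with
      | one => rw [hcons] at this; omega
      | of_mul z' t' =>
        obtain ⟨rfl, rfl⟩ := freeMonoid_cons_inj hx
        obtain ⟨rfl, rfl⟩ := freeMonoid_cons_inj hy
        have e : PresentedMonoid.mk (SingPosRel n) w₂ = PresentedMonoid.mk _ w₂' :=
          PresentedMonoid.mk_eq_mk_iff.2 h₂
        have hu' : singLen (PresentedMonoid.mk (SingPosRel n) (t * w₂)) ≤ N := hu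
        rw [map_mul, singLen_mul] at hu'
        have := (ih₁ z t z' t' rfl rfl (by omega)).mul (PresentedMonoid.mk _ w₂)
        rw [← map_mul, e, ← map_mul] at this
        exact this

theorem linked_of_lt (N : ℕ) : ∀ a b W V, singLen W < N → posLetter n a * W = posLetter n b * V →
    Linked (complement nodeProximity) (posLetter n) a W b V := by
  induction N with
  | zero => intro a b W V h; omega
  | succ N ih =>
    intro a b W V hW h
    obtain ⟨w, rfl⟩ := PresentedMonoid.surjective_mk W
    obtain ⟨v, rfl⟩ := PresentedMonoid.surjective_mk V
    have hnode (a : Bool × Fin (n - 1)) : ∃ x : PosGen n, x.node = a := by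
      obtain ⟨k, i⟩ := a
      cases k
      exacts [⟨.sing i, rfl⟩, ⟨.sigma i, rfl⟩]
    obtain ⟨x, rfl⟩ := hnode a
    obtain ⟨y, rfl⟩ := hnode b
    rw [posLetter_node, posLetter_node, PresentedMonoid.of, PresentedMonoid.of, ← map_mul,
      ← map_mul] at h
    exact linked_of_conGen N ih _ _ (PresentedMonoid.mk_eq_mk_iff.1 h) x w y v rfl rfl (by omega)

/-- Two generators with a common right multiple have a least one, which the complement computes. -/
theorem linked_of_mul_eq {a b : Bool × Fin (n - 1)} {W V : SBPos n}
    (h : posLetter n a * W = posLetter n b * V) :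
    Linked (complement nodeProximity) (posLetter n) a W b V :=
  linked_of_lt _ a b W V (Nat.lt_succ_self _) h

/-! ### Reading words backwards -/

section Reversal

open MulOpposite

/-- Reading words backwards, as a homomorphism from `SBₙ⁺` to its opposite. -/
def posRevHom (n : ℕ) : SBPos n →* (SBPos n)ᵐᵒᵖ :=
  PresentedMonoid.lift (fun g => op (PresentedMonoid.of (SingPosRel n) g)) (by
    intro a b h
    apply unop_injective
    cases h with
    | sigma_comm i j h => exact (PresentedMonoid.mk_eq_mk_of_rel (SingPosRel.sigma_comm i j h)).symm
    | sing_comm i j h => exact (PresentedMonoid.mk_eq_mk_of_rel (SingPosRel.sing_comm i j h)).symm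
    | sing_sigma_comm i j h =>
      exact (PresentedMonoid.mk_eq_mk_of_rel (SingPosRel.sing_sigma_comm i j h)).symm
    | braid i j h => exact PresentedMonoid.mk_eq_mk_of_rel (SingPosRel.braid i j h)
    -- Reversal exchanges the two mixed relations.
    | mixed_up i j h =>
      exact (PresentedMonoid.mk_eq_mk_of_rel (SingPosRel.mixed_down i j h)).symm
    | mixed_down i j h =>
      exact (PresentedMonoid.mk_eq_mk_of_rel (SingPosRel.mixed_up i j h)).symm)

/-- Reading words backwards, as a homomorphism from `Brₙ⁺` to its opposite. -/
def brRevHom (n : ℕ) : BrPos n →* (BrPos n)ᵐᵒᵖ :=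
  PresentedMonoid.lift (fun g => op (PresentedMonoid.of (BraidRel n) g)) (by
    intro a b h
    apply unop_injective
    cases h with
    | comm i j h => exact (PresentedMonoid.mk_eq_mk_of_rel (BraidRel.comm i j h)).symm
    | braid i j h => exact PresentedMonoid.mk_eq_mk_of_rel (BraidRel.braid i j h))

/-- Reading words backwards, as a homomorphism from `SBₙ` to its opposite. -/
def sbRevHom (n : ℕ) : SB n →* (SB n)ᵐᵒᵖ :=
  PresentedMonoid.lift (fun g => op (PresentedMonoid.of (SingRel n) g)) (by
    intro a b h
    apply unop_injective
    cases h with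
    | sigma_comm i j h => exact (PresentedMonoid.mk_eq_mk_of_rel (SingRel.sigma_comm i j h)).symm
    | sing_comm i j h => exact (PresentedMonoid.mk_eq_mk_of_rel (SingRel.sing_comm i j h)).symm
    | sing_sigma_comm i j h =>
      exact (PresentedMonoid.mk_eq_mk_of_rel (SingRel.sing_sigma_comm i j h)).symm
    | braid i j h => exact PresentedMonoid.mk_eq_mk_of_rel (SingRel.braid i j h)
    | mixed_up i j h =>
      exact (PresentedMonoid.mk_eq_mk_of_rel (SingRel.mixed_down i j h)).symm
    | mixed_down i j h =>
      exact (PresentedMonoid.mk_eq_mk_of_rel (SingRel.mixed_up i j h)).symm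
    | mul_inv i => exact PresentedMonoid.mk_eq_mk_of_rel (SingRel.inv_mul i)
    | inv_mul i => exact PresentedMonoid.mk_eq_mk_of_rel (SingRel.mul_inv i))

/-- The reverse of a positive singular braid. -/
def posRev (W : SBPos n) : SBPos n := unop (posRevHom n W)

/-- The reverse of a positive braid. -/
def brRev (A : BrPos n) : BrPos n := unop (brRevHom n A)

/-- The reverse of a singular braid. -/
def sbRev (w : SB n) : SB n := unop (sbRevHom n w)

@[simp] theorem posRev_one : posRev (1 : SBPos n) = 1 := by simp [posRev]

@[simp] theorem posRev_mul (W V : SBPos n) : posRev (W * V) = posRev V * posRev W := by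
  simp [posRev]

@[simp] theorem posRev_of (x : PosGen n) :
    posRev (PresentedMonoid.of (SingPosRel n) x) = PresentedMonoid.of _ x := rfl

@[simp] theorem posRev_xPos (i : Fin (n - 1)) : posRev (xPos n i) = xPos n i := rfl

@[simp] theorem posRev_sPos (i : Fin (n - 1)) : posRev (sPos n i) = sPos n i := rfl

@[simp] theorem brRev_one : brRev (1 : BrPos n) = 1 := by simp [brRev]

@[simp] theorem brRev_mul (A B : BrPos n) : brRev (A * B) = brRev B * brRev A := by
  simp [brRev]

@[simp] theorem brRev_of (i : Fin (n - 1)) :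
    brRev (PresentedMonoid.of (BraidRel n) i) = PresentedMonoid.of _ i := rfl

@[simp] theorem sbRev_one : sbRev (1 : SB n) = 1 := by simp [sbRev]

@[simp] theorem sbRev_mul (w v : SB n) : sbRev (w * v) = sbRev v * sbRev w := by
  simp [sbRev]

@[simp] theorem sbRev_of (x : Gen n) :
    sbRev (PresentedMonoid.of (SingRel n) x) = PresentedMonoid.of _ x := rfl

/-- Induction on the elements of a presented monoid, adding one generator on the left. -/
theorem presentedMonoid_induction {α : Type*} {r : FreeMonoid α → FreeMonoid α → Prop}
    {p : PresentedMonoid r → Prop} (one : p 1)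
    (mul : ∀ a W, p W → p (PresentedMonoid.of r a * W)) (W : PresentedMonoid r) : p W := by
  obtain ⟨w, rfl⟩ := PresentedMonoid.surjective_mk W
  induction w using FreeMonoid.recOn with
  | one => exact one
  | of_mul x u hu => rw [map_mul]; exact mul x _ hu

@[simp] theorem posRev_posRev (W : SBPos n) : posRev (posRev W) = W := by
  induction W using presentedMonoid_induction with
  | one => simp
  | mul a W ih => simp [ih]

@[simp] theorem brRev_brRev (A : BrPos n) : brRev (brRev A) = A := by
  induction A using presentedMonoid_induction with
  | one => simp
  | mul a A ih => simp [ih]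

@[simp] theorem sbRev_sbRev (w : SB n) : sbRev (sbRev w) = w := by
  induction w using presentedMonoid_induction with
  | one => simp
  | mul a w ih => simp [ih]

@[simp] theorem brToSing_of (i : Fin (n - 1)) :
    brToSing n (PresentedMonoid.of _ i) = sPos n i := rfl

theorem posRev_brToSing (A : BrPos n) : posRev (brToSing n A) = brToSing n (brRev A) := by
  induction A using presentedMonoid_induction with
  | one => simp
  | mul a A ih => simp [ih]

theorem sbRev_posToSB (W : SBPos n) : sbRev (posToSB n W) = posToSB n (posRev W) := by
  induction W using presentedMonoid_induction with
  | one => simp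
  | mul a W ih =>
    simp only [map_mul, sbRev_mul, ih, posRev_mul, posRev_of]
    cases a <;> rfl

end Reversal

/-! ### Cancellation -/

section Cancellation

theorem complement_self (a : Bool × Fin (n - 1)) : complement nodeProximity a a = some [] := by
  obtain ⟨k, i⟩ := a
  cases k <;> simp [complement, nodeProximity]

/-- The complement of a letter with itself is empty, so the link between `a * W` and `a * V` says
that `W` and `V` are the same element. -/
instance : IsLeftCancelMul (SBPos n) where
  mul_left_cancel W V V' h := by
    induction W using SBPos.induction_left with
    | one => simpa using h
    | mul a W ih =>
      simp only [mul_assoc] at h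
      obtain ⟨s, t, U, hs, ht, h₁, h₂⟩ := linked_of_mul_eq h
      rw [complement_self, Option.some.injEq] at hs ht
      subst hs ht
      exact ih (h₁.trans h₂.symm)

instance : IsRightCancelMul (SBPos n) where
  mul_right_cancel W V V' h := by
    have := congrArg posRev h
    simp only [posRev_mul] at this
    simpa using congrArg posRev (mul_left_cancel this)

end Cancellation

/-! ### Positive braids inside the positive singular braids -/

section Braids

@[simp] theorem len_one : len (1 : BrPos n) = 0 := by simp [len]

@[simp] theorem len_mul (A B : BrPos n) : len (A * B) = len A + len B := by simp [len]

@[simp] theorem len_of (i : Fin (n - 1)) : len (PresentedMonoid.of (BraidRel n) i) = 1 := rfl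

@[simp] theorem singLen_brToSing (A : BrPos n) : singLen (brToSing n A) = len A := by
  induction A using presentedMonoid_induction with
  | one => simp
  | mul a A ih => simp [ih]

theorem len_eq_zero {A : BrPos n} : len A = 0 ↔ A = 1 := by
  refine ⟨fun h => ?_, by rintro rfl; simp⟩
  induction A using presentedMonoid_induction with
  | one => rfl
  | mul a A ih => simp at h

/-- The retraction of `SBₙ⁺` onto `Brₙ⁺`, with a zero adjoined, that kills every `xᵢ`. -/
def brProj (n : ℕ) : SBPos n →* WithZero (BrPos n) :=
  PresentedMonoid.lift
    (fun g => match g with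
      | PosGen.sigma i => ((PresentedMonoid.of (BraidRel n) i : BrPos n) : WithZero (BrPos n))
      | PosGen.sing _ => 0) (by
    intro a b h
    cases h with
    | sigma_comm i j h =>
      exact congrArg ((↑) : BrPos n → WithZero (BrPos n))
        (PresentedMonoid.mk_eq_mk_of_rel (BraidRel.comm i j h))
    | braid i j h =>
      exact congrArg ((↑) : BrPos n → WithZero (BrPos n))
        (PresentedMonoid.mk_eq_mk_of_rel (BraidRel.braid i j h))
    | _ => simp)

@[simp] theorem brProj_sPos (i : Fin (n - 1)) :
    brProj n (sPos n i) = ((PresentedMonoid.of (BraidRel n) i : BrPos n) : WithZero (BrPos n)) :=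
  rfl

@[simp] theorem brProj_xPos (i : Fin (n - 1)) : brProj n (xPos n i) = 0 := rfl

@[simp] theorem brProj_brToSing (A : BrPos n) : brProj n (brToSing n A) = A := by
  induction A using presentedMonoid_induction with
  | one => simp
  | mul a A ih => simp [ih]

theorem brToSing_injective : Function.Injective (brToSing n) := fun A B h => by
  simpa using congrArg (brProj n) h

/-- A singular letter would make the projection vanish, so a word for `W` contains none. -/
theorem eq_brToSing_of_brProj_eq {W : SBPos n} {A : BrPos n} (h : brProj n W = A) :
    W = brToSing n A := by
  induction W using SBPos.induction_left generalizing A with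
  | one =>
    rw [map_one, ← WithZero.coe_one, WithZero.coe_inj] at h
    simp [← h]
  | mul a W ih =>
    obtain ⟨k, i⟩ := a
    cases k with
    | false => simp [posLetter] at h
    | true =>
      simp only [posLetter, map_mul, brProj_sPos] at h
      cases hW : brProj n W using WithZero.recZeroCoe with
      | zero => simp [hW] at h
      | coe B =>
        rw [hW, ← WithZero.coe_mul, WithZero.coe_inj] at h
        rw [ih hW, ← h]
        simp [posLetter]

theorem eq_brToSing_of_mul_eq {A : BrPos n} {V W : SBPos n} (h : brToSing n A = V * W) :
    ∃ B C, V = brToSing n B ∧ W = brToSing n C ∧ A = B * C := by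
  have h' := congrArg (brProj n) h
  rw [brProj_brToSing, map_mul] at h'
  cases hV : brProj n V using WithZero.recZeroCoe with
  | zero => simp [hV] at h'
  | coe B =>
    cases hW : brProj n W using WithZero.recZeroCoe with
    | zero => simp [hW] at h'
    | coe C =>
      refine ⟨B, C, eq_brToSing_of_brProj_eq hV, eq_brToSing_of_brProj_eq hW, ?_⟩
      rwa [hV, hW, ← WithZero.coe_mul, WithZero.coe_inj] at h'

theorem brToSing_dvd_brToSing {A B : BrPos n} : brToSing n A ∣ brToSing n B ↔ A ∣ B := by
  constructor
  · rintro ⟨W, h⟩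
    obtain ⟨C, D, hC, -, rfl⟩ := eq_brToSing_of_mul_eq h
    rw [brToSing_injective hC]
    exact dvd_mul_right _ _
  · exact map_dvd _

instance : IsLeftCancelMul (BrPos n) where
  mul_left_cancel A B C h := by
    have := congrArg (brToSing n) h
    simp only [map_mul] at this
    exact brToSing_injective (mul_left_cancel this)

/-- The complement of two letters $\sigma$ involves no singular letter. Thus their least common
multiple in $SB_n^+$ is a braid, even when it is tested against singular multiples. -/
theorem exists_sigma_lcm (i j : Fin (n - 1)) : ∃ u v : BrPos n,
    PresentedMonoid.of _ i * u = PresentedMonoid.of _ j * v ∧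
      ∀ W V, sPos n i * W = sPos n j * V →
        ∃ U, W = brToSing n u * U ∧ V = brToSing n v * U := by
  have link (W V : SBPos n) (h : sPos n i * W = sPos n j * V) :=
    linked_of_mul_eq (a := (true, i)) (b := (true, j)) h
  have rel (u v : BrPos n) (h : sPos n i * brToSing n u = sPos n j * brToSing n v) :
      PresentedMonoid.of (BraidRel n) i * u = PresentedMonoid.of _ j * v :=
    brToSing_injective (by simpa using h)
  have hc := nodeProximity_comm i j
  simp only [Linked, complement] at link
  cases h : nodeProximity i j with
  | same =>
    obtain rfl := nodeProximity_eq_same h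
    exact ⟨1, 1, rfl, fun W V e => ⟨W, by simp, by simp [mul_left_cancel e]⟩⟩
  | far =>
    rw [h] at hc
    simp only [h, ← hc] at link
    refine ⟨PresentedMonoid.of _ j, PresentedMonoid.of _ i, rel _ _ ?_, fun W V e => ?_⟩
    · exact sPos_comm (nodeProximity_eq_far h)
    · obtain ⟨s, t, U, hs, ht, rfl, rfl⟩ := link W V e
      cases hs
      cases ht
      exact ⟨U, by simp [posLetter], by simp [posLetter]⟩
  | adj =>
    rw [h] at hc
    simp only [h, ← hc] at link
    refine ⟨PresentedMonoid.of _ j * PresentedMonoid.of _ i,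
      PresentedMonoid.of _ i * PresentedMonoid.of _ j, rel _ _ ?_, fun W V e => ?_⟩
    · simpa using sPos_braid (nodeProximity_eq_adj h)
    · obtain ⟨s, t, U, hs, ht, rfl, rfl⟩ := link W V e
      cases hs
      cases ht
      exact ⟨U, by simp [posLetter], by simp [posLetter]⟩

/-- Two braids that divide both `W` and `W'` have a common multiple that divides both. -/
theorem exists_common_multiple {A B : BrPos n} {W W' : SBPos n}
    (hA : brToSing n A ∣ W) (hA' : brToSing n A ∣ W') (hB : brToSing n B ∣ W)
    (hB' : brToSing n B ∣ W') :
    ∃ C, A ∣ C ∧ B ∣ C ∧ brToSing n C ∣ W ∧ brToSing n C ∣ W' := by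
  induction hN : singLen W using Nat.strong_induction_on generalizing A B W W' with | _ N ih
  subst hN
  induction A using presentedMonoid_induction with
  | one => exact ⟨B, one_dvd _, dvd_rfl, hB, hB'⟩
  | mul i A _ =>
  induction B using presentedMonoid_induction with
  | one => exact ⟨_, dvd_rfl, one_dvd _, hA, hA'⟩
  | mul j B _ =>
  obtain ⟨u, v, huv, hl⟩ := exists_sigma_lcm i j
  simp only [map_mul, brToSing_of] at hA hA' hB hB'
  obtain ⟨X, rfl⟩ := hA
  obtain ⟨X', rfl⟩ := hA'
  obtain ⟨Y, hY⟩ := hB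
  obtain ⟨Y', hY'⟩ := hB'
  simp only [mul_assoc] at hY hY' ih ⊢
  obtain ⟨U, hU, hV⟩ := hl _ _ hY
  obtain ⟨U', hU', hV'⟩ := hl _ _ hY'
  have l₁ := congrArg singLen hU
  have l₂ := congrArg singLen hV
  have l₃ := congrArg singLen hY
  simp only [singLen_mul, singLen_sPos, singLen_brToSing] at l₁ l₂ l₃
  -- With `u`, `v` completing the first letters to their least common multiple, the induction
  -- hypothesis serves `A` and `u`, then `B` and `v`, and finally the two remainders `E₁`, `E₂`,
  -- each time below a shorter element.
  obtain ⟨C₁, hAC, ⟨E₁, rfl⟩, ⟨Z₁, hZ₁⟩, ⟨Z₁', hZ₁'⟩⟩ :=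
    ih _ (by simp) (W := brToSing n A * X) (W' := brToSing n A * X') (A := A) (B := u)
      ⟨_, rfl⟩ ⟨_, rfl⟩ ⟨_, hU⟩ ⟨_, hU'⟩ rfl
  obtain ⟨C₂, hBC, ⟨E₂, rfl⟩, ⟨Z₂, hZ₂⟩, ⟨Z₂', hZ₂'⟩⟩ :=
    ih _ (by simp; omega) (W := brToSing n B * Y) (W' := brToSing n B * Y') (A := B) (B := v)
      ⟨_, rfl⟩ ⟨_, rfl⟩ ⟨_, hV⟩ ⟨_, hV'⟩ rfl
  rw [map_mul, mul_assoc] at hZ₁ hZ₁' hZ₂ hZ₂'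
  have e₁ := mul_left_cancel (hU.symm.trans hZ₁)
  have e₁' := mul_left_cancel (hU'.symm.trans hZ₁')
  have e₂ := mul_left_cancel (hV.symm.trans hZ₂)
  have e₂' := mul_left_cancel (hV'.symm.trans hZ₂')
  obtain ⟨E, ⟨F₁, rfl⟩, ⟨F₂, hF⟩, ⟨T, hT⟩, ⟨T', hT'⟩⟩ :=
    ih (singLen U) (by simp; omega) (W := U) (W' := U') (A := E₁) (B := E₂)
      ⟨_, e₁⟩ ⟨_, e₁'⟩ ⟨_, e₂⟩ ⟨_, e₂'⟩ rfl
  refine ⟨PresentedMonoid.of _ i * (u * (E₁ * F₁)), ?_, ?_, ⟨T, ?_⟩, ⟨T', ?_⟩⟩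
  · rw [← mul_assoc u]
    exact mul_dvd_mul_left _ (hAC.mul_right _)
  · rw [← mul_assoc, huv, hF, mul_assoc, ← mul_assoc v]
    exact mul_dvd_mul_left _ (hBC.mul_right _)
  · rw [hU, hT]; simp [mul_assoc]
  · rw [hU', hT']; simp [mul_assoc]

end Braids

/-! ### The staircase word and its symmetry -/

section Staircase

variable {M : Type*} [Monoid M]

/-- The product `s₀ s₁ ⋯ sₖ₋₁`. -/
def ascending (s : ℕ → M) : ℕ → M
  | 0 => 1
  | k + 1 => ascending s k * s k

/-- The product `sₖ₋₁ ⋯ s₁ s₀`. -/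
def descending (s : ℕ → M) : ℕ → M
  | 0 => 1
  | k + 1 => s k * descending s k

/-- The product `(s₀ ⋯ sₖ₋₁) (s₀ ⋯ sₖ₋₂) ⋯ s₀`. -/
def staircase (s : ℕ → M) : ℕ → M
  | 0 => 1
  | k + 1 => ascending s (k + 1) * staircase s k

/-- The relations of the first `N` members of `s` and `y` that are common to the braid relations
(`y = s`) and to the mixed relations. -/
structure MixedRelations (s y : ℕ → M) (N : ℕ) : Prop where
  far : ∀ i j, i + 1 < j → j < N → s i * y j = y j * s i
  far' : ∀ i j, i + 1 < j → j < N → s j * y i = y i * s j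
  self : ∀ i, i < N → s i * y i = y i * s i
  up : ∀ i, i + 1 < N → s i * (s (i + 1) * y i) = y (i + 1) * (s i * s (i + 1))
  down : ∀ i, i + 1 < N → s (i + 1) * (s i * y (i + 1)) = y i * (s (i + 1) * s i)

variable {s y : ℕ → M} {N : ℕ}

theorem MixedRelations.ascending_comm (h : MixedRelations s y N) {k j : ℕ} (hk : k < j)
    (hj : j < N) : ascending s k * y j = y j * ascending s k := by
  induction k with
  | zero => simp [ascending]
  | succ k ih =>
    rw [ascending, mul_assoc, h.far k j hk hj, ← mul_assoc, ih (by omega), mul_assoc]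

theorem MixedRelations.ascending_shift (h : MixedRelations s y N) {k i : ℕ} (hi : i + 1 < k)
    (hk : k ≤ N) : ascending s k * y i = y (i + 1) * ascending s k := by
  induction k with
  | zero => omega
  | succ k ih =>
    rcases Nat.lt_or_ge (i + 1) k with hik | hik
    · rw [ascending, mul_assoc, h.far' i k hik hk, ← mul_assoc, ih hik (by omega), mul_assoc]
    · obtain rfl : k = i + 1 := by omega
      rw [ascending, ascending, mul_assoc, mul_assoc, h.up i hk, ← mul_assoc,
        h.ascending_comm (Nat.lt_succ_self i) hk]
      simp only [mul_assoc]

/-- A single row only raises indices; two consecutive rows together carry the top letter down to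
index `0`, one `down` relation per step. -/
theorem MixedRelations.ascending_mul_ascending (hs : MixedRelations s s N)
    (h : MixedRelations s y N) {t : ℕ} (ht : t < N) :
    ascending s (t + 1) * ascending s t * y t = y 0 * (ascending s (t + 1) * ascending s t) := by
  induction t with
  | zero => simpa [ascending] using h.self 0 ht
  | succ t ih =>
    have e : ascending s (t + 1 + 1) * ascending s (t + 1) =
        ascending s (t + 1) * ascending s t * (s (t + 1) * s t) := by
      rw [ascending, mul_assoc, ascending, ← mul_assoc (s (t + 1)) _ (s t),
        ← hs.ascending_comm (Nat.lt_succ_self t) ht]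
      simp only [mul_assoc]
    rw [e, mul_assoc, mul_assoc (s (t + 1)), h.down t ht, ← mul_assoc _ (y t), ih (by omega),
      mul_assoc]

theorem MixedRelations.staircase_comm (h : MixedRelations s y N) {k j : ℕ} (hk : k < j)
    (hj : j < N) : staircase s k * y j = y j * staircase s k := by
  induction k with
  | zero => simp [staircase]
  | succ k ih =>
    rw [staircase, mul_assoc, ih (by omega), ← mul_assoc, h.ascending_comm hk hj, mul_assoc]

/-- For `j > 0` the smaller staircase flips the index and the first row shifts it by one. For `j =
0` the letter has top index: it commutes with the inner staircase and then crosses the first two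
rows at once. -/
theorem MixedRelations.staircase_mul (hs : MixedRelations s s N) (h : MixedRelations s y N)
    {k i j : ℕ} (hij : i + j + 1 = k) (hk : k ≤ N) : staircase s k * y i = y j * staircase s k := by
  induction k generalizing i j with
  | zero => omega
  | succ k ih =>
    rw [staircase]
    rcases j with _ | j
    · obtain rfl : i = k := by omega
      rcases i with _ | i
      · simpa [staircase, ascending] using h.self 0 hk
      · rw [staircase, mul_assoc, mul_assoc, h.staircase_comm (Nat.lt_succ_self i) hk,
          ← mul_assoc, ← mul_assoc, hs.ascending_mul_ascending h hk]
        simp only [mul_assoc]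
    · rw [mul_assoc, ih (i := i) (j := j) (by omega) (by omega), ← mul_assoc,
        h.ascending_shift (by omega) hk, mul_assoc]

/-- The last letter of the first row commutes with all but the two longest rows, so it can be moved
into a column on the right. -/
theorem MixedRelations.staircase_succ (hs : MixedRelations s s N) {k : ℕ} (hk : k < N) :
    staircase s (k + 1) = staircase s k * descending s (k + 1) := by
  induction k with
  | zero => simp [staircase, ascending, descending]
  | succ k ih =>
    calc staircase s (k + 1 + 1)
        = ascending s (k + 1) * (s (k + 1) * staircase s k) * descending s (k + 1) := by
          rw [staircase, ih (by omega), ascending]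
          simp only [mul_assoc]
      _ = _ := by
          rw [← hs.staircase_comm (Nat.lt_succ_self k) hk, staircase,
            show descending s (k + 1 + 1) = s (k + 1) * descending s (k + 1) from rfl]
          simp only [mul_assoc]

theorem exists_staircase_eq_mul (s : ℕ → M) (k : ℕ) : ∃ X, staircase s (k + 1) = X * s 0 := by
  induction k with
  | zero => exact ⟨1, by simp [staircase, ascending]⟩
  | succ k ih =>
    obtain ⟨X, hX⟩ := ih
    exact ⟨_, by rw [staircase, hX, mul_assoc]⟩

theorem MixedRelations.dvd_staircase [IsRightCancelMul M] (hs : MixedRelations s s N) {i k : ℕ}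
    (hi : i < k) (hk : k ≤ N) : s i ∣ staircase s k := by
  induction k with
  | zero => omega
  | succ k ih =>
    rcases Nat.lt_succ_iff_lt_or_eq.1 hi with h | rfl
    · rw [hs.staircase_succ hk]
      exact (ih h (by omega)).mul_right _
    · obtain ⟨X, hX⟩ := exists_staircase_eq_mul s i
      -- The staircase is `X * s 0`; moving `s 0` across the staircase turns it into `s i`, and
      -- cancelling `s 0` leaves `s i * X`.
      refine ⟨X, mul_right_cancel (b := s 0) ?_⟩
      rw [mul_assoc, ← hX, hs.staircase_mul hs (j := i) (by omega) hk]

theorem prod_filter_range (s : ℕ → M) (N t : ℕ) :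
    (((List.range N).filter (· ≤ t)).map s).prod = ascending s (min N (t + 1)) := by
  induction N with
  | zero => simp [ascending]
  | succ N ih =>
    rw [List.range_succ, List.filter_append, List.map_append, List.prod_append, ih]
    by_cases h : N ≤ t
    · rw [min_eq_left (by omega), min_eq_left (by omega), ascending]
      simp [h]
    · rw [min_eq_right (by omega), min_eq_right (by omega)]
      simp [h]

theorem prod_map_garsideWord (f : Fin (n - 1) → M) (s : ℕ → M) (h : ∀ i, f i = s i) :
    ((garsideWord n).map f).prod = staircase s (n - 1) := by
  have hrow (t : Fin (n - 1)) :
      (((List.finRange (n - 1)).filter fun k => k ≤ t).map f).prod = ascending s (t + 1) := by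
    have := prod_filter_range s (n - 1) t
    rw [min_eq_right (by omega), ← List.map_coe_finRange_eq_range, List.filter_map,
      List.map_map] at this
    rw [← this]
    congr 1
    have : f = s ∘ Fin.val := funext h
    rw [this]
    rfl
  have hstair (N : ℕ) :
      ((List.range N).map fun t => ascending s (t + 1)).reverse.prod = staircase s N := by
    induction N with
    | zero => simp [staircase]
    | succ N ih => simp [List.range_succ, staircase, ← ih]
  rw [garsideWord, List.map_flatMap, List.flatMap_def, List.prod_flatten, List.map_map,
    ← hstair, ← List.map_coe_finRange_eq_range, List.map_map, ← List.map_reverse]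
  congr 2
  funext t
  exact hrow t

end Staircase

/-! ### Garside's element -/

section Garside

/-- The generators `σᵢ` of `SBₙ⁺`, extended by `1`. -/
def posSeq (n : ℕ) (b : Bool) (k : ℕ) : SBPos n :=
  if h : k < n - 1 then posLetter n (b, ⟨k, h⟩) else 1

theorem posSeq_of_lt (b : Bool) {k : ℕ} (h : k < n - 1) :
    posSeq n b k = posLetter n (b, ⟨k, h⟩) := dif_pos h

/-- Garside's element `Δ` in `SBₙ⁺`. -/
def posGarside (n : ℕ) : SBPos n := brToSing n (garside n)

theorem posGarside_eq_staircase : posGarside n = staircase (posSeq n true) (n - 1) := by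
  rw [posGarside, garside, map_list_prod, List.map_map]
  exact prod_map_garsideWord _ _ fun i => by simp [posSeq, posLetter]

theorem mixedRelations_posSeq (b : Bool) :
    MixedRelations (posSeq n true) (posSeq n b) (n - 1) where
  far i j hij hj := by
    have h : 1 < |(j : ℤ) - i| := by rw [abs_of_pos] <;> omega
    have h' : 1 < |(i : ℤ) - j| := by rwa [abs_sub_comm]
    rw [posSeq_of_lt _ hj, posSeq_of_lt _ (by omega)]
    cases b
    · exact (xPos_mul_sPos (i := ⟨j, hj⟩) (j := ⟨i, by omega⟩) h.ne').symm
    · exact sPos_comm (i := ⟨i, by omega⟩) (j := ⟨j, hj⟩) h'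
  far' i j hij hj := by
    have h : 1 < |(j : ℤ) - i| := by rw [abs_of_pos] <;> omega
    have h' : 1 < |(i : ℤ) - j| := by rwa [abs_sub_comm]
    rw [posSeq_of_lt _ hj, posSeq_of_lt _ (by omega)]
    cases b
    · exact (xPos_mul_sPos (i := ⟨i, by omega⟩) (j := ⟨j, hj⟩) h'.ne').symm
    · exact sPos_comm (i := ⟨j, hj⟩) (j := ⟨i, by omega⟩) h
  self i hi := by
    rw [posSeq_of_lt _ hi, posSeq_of_lt _ hi]
    cases b
    · exact (xPos_mul_sPos (i := ⟨i, hi⟩) (j := ⟨i, hi⟩) (by simp)).symm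
    · rfl
  up i hi := by
    have h : |(i : ℤ) - (i + 1 : ℕ)| = 1 := by simp
    rw [posSeq_of_lt _ hi, posSeq_of_lt _ (show i < n - 1 by omega), posSeq_of_lt _ hi,
      posSeq_of_lt _ (show i < n - 1 by omega)]
    cases b
    · exact sPos_mul_sPos_mul_xPos (i := ⟨i, by omega⟩) (j := ⟨i + 1, hi⟩) h
    · exact sPos_braid (i := ⟨i, by omega⟩) (j := ⟨i + 1, hi⟩) h
  down i hi := by
    have h : |((i + 1 : ℕ) : ℤ) - i| = 1 := by simp
    rw [posSeq_of_lt _ hi, posSeq_of_lt _ (show i < n - 1 by omega), posSeq_of_lt _ hi,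
      posSeq_of_lt _ (show i < n - 1 by omega)]
    cases b
    · exact sPos_mul_sPos_mul_xPos (j := ⟨i, by omega⟩) (i := ⟨i + 1, hi⟩) h
    · exact sPos_braid (j := ⟨i, by omega⟩) (i := ⟨i + 1, hi⟩) h

theorem posGarside_mul_posLetter (b : Bool) (i j : Fin (n - 1)) (h : (i : ℕ) + j + 1 = n - 1) :
    posGarside n * posLetter n (b, i) = posLetter n (b, j) * posGarside n := by
  have := (mixedRelations_posSeq (n := n) true).staircase_mul (mixedRelations_posSeq b) h le_rfl
  rwa [posSeq_of_lt _ i.2, posSeq_of_lt _ j.2, ← posGarside_eq_staircase] at this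

theorem exists_posGarside_mul (W : SBPos n) : ∃ V, posGarside n * W = V * posGarside n := by
  induction W using SBPos.induction_left with
  | one => exact ⟨1, by simp⟩
  | mul a W ih =>
    obtain ⟨V, hV⟩ := ih
    obtain ⟨b, i⟩ := a
    -- The flip induced by $\Delta$ on zero-based indices is `i ↦ n - 2 - i`.
    refine ⟨posLetter n (b, ⟨n - 1 - 1 - i, by omega⟩) * V, ?_⟩
    rw [← mul_assoc, posGarside_mul_posLetter b i ⟨n - 1 - 1 - i, by omega⟩ (by simp; omega),
      mul_assoc, hV, mul_assoc]

theorem exists_mul_posGarside (W : SBPos n) : ∃ V, W * posGarside n = posGarside n * V := by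
  induction W using SBPos.induction_left with
  | one => exact ⟨1, by simp⟩
  | mul a W ih =>
    obtain ⟨V, hV⟩ := ih
    obtain ⟨b, i⟩ := a
    refine ⟨posLetter n (b, ⟨n - 1 - 1 - i, by omega⟩) * V, ?_⟩
    rw [mul_assoc, hV, ← mul_assoc, ← mul_assoc,
      posGarside_mul_posLetter b ⟨n - 1 - 1 - i, by omega⟩ i (by simp; omega)]

theorem sPos_dvd_posGarside (i : Fin (n - 1)) : sPos n i ∣ posGarside n := by
  have := (mixedRelations_posSeq (n := n) true).dvd_staircase i.2 le_rfl
  rwa [posSeq_of_lt _ i.2, ← posGarside_eq_staircase] at this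

theorem of_dvd_garside (i : Fin (n - 1)) : PresentedMonoid.of (BraidRel n) i ∣ garside n :=
  brToSing_dvd_brToSing.1 (sPos_dvd_posGarside i)

-- Reversal turns the rows of the staircase into columns, and `staircase_succ` decomposes it by
-- columns.
@[simp] theorem posRev_posGarside : posRev (posGarside n) = posGarside n := by
  have hdesc (k : ℕ) : posRev (ascending (posSeq n true) k) = descending (posSeq n true) k := by
    induction k with
    | zero => simp [ascending, descending]
    | succ k ih =>
      rw [ascending, descending, posRev_mul, ih]
      by_cases h : k < n - 1 <;> simp [posSeq, h, posLetter]
  have hstair (k : ℕ) (hk : k ≤ n - 1) :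
      posRev (staircase (posSeq n true) k) = staircase (posSeq n true) k := by
    induction k with
    | zero => simp [staircase]
    | succ k ih =>
      rw [staircase, posRev_mul, ih (by omega), hdesc]
      exact ((mixedRelations_posSeq true).staircase_succ hk).symm
  rw [posGarside_eq_staircase, hstair _ le_rfl]

@[simp] theorem brRev_garside : brRev (garside n) = garside n := by
  apply brToSing_injective
  rw [← posRev_brToSing]
  exact posRev_posGarside

theorem exists_posGarside_eq_mul_sPos (i : Fin (n - 1)) : ∃ Y, posGarside n = Y * sPos n i := by
  obtain ⟨Y, hY⟩ := sPos_dvd_posGarside i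
  exact ⟨posRev Y, by simpa using congrArg posRev hY⟩

/-- If $\Delta = BAC$, then $B\Delta = \Delta V = BACV$ for some $V$, and $B$ cancels. -/
theorem isFragment_iff_dvd {A : BrPos n} : IsFragment A ↔ A ∣ garside n := by
  constructor
  · rintro ⟨B, C, h⟩
    obtain ⟨V, hV⟩ := exists_mul_posGarside (brToSing n B)
    refine brToSing_dvd_brToSing.1 ⟨brToSing n C * V, mul_left_cancel (a := brToSing n B) ?_⟩
    change _ * posGarside n = _
    rw [hV, posGarside, h]
    simp [mul_assoc]
  · rintro ⟨C, h⟩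
    exact ⟨1, C, by rw [one_mul, h]⟩

theorem isFragment_brRev_iff {A : BrPos n} : IsFragment (brRev A) ↔ IsFragment A := by
  have key {A : BrPos n} (h : IsFragment A) : IsFragment (brRev A) := by
    obtain ⟨B, C, h⟩ := h
    refine ⟨brRev C, brRev B, ?_⟩
    rw [← brRev_garside, h]
    simp [mul_assoc]
  exact ⟨fun h => by simpa using key h, key⟩

end Garside

/-! ### Fractions and the embedding into the singular braid monoid -/

section Embedding

theorem exists_pow_posGarside_mul (W : SBPos n) (k : ℕ) :
    ∃ V, posGarside n ^ k * W = V * posGarside n ^ k := by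
  induction k generalizing W with
  | zero => exact ⟨W, by simp⟩
  | succ k ih =>
    obtain ⟨V, hV⟩ := ih W
    obtain ⟨U, hU⟩ := exists_posGarside_mul V
    exact ⟨U, by rw [pow_succ', mul_assoc, hV, ← mul_assoc, hU, mul_assoc]⟩

theorem exists_mul_eq_of_mem_powers (W : SBPos n) (s : Submonoid.powers (posGarside n)) :
    ∃ V, s * W = V * s := by
  obtain ⟨_, k, rfl⟩ := s
  exact exists_pow_posGarside_mul W k

/-- Powers of $\Delta$ can be moved across any element, so the Ore condition holds without changing
the denominator. -/
noncomputable instance : OreLocalization.OreSet (Submonoid.powers (posGarside n)) where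
  ore_right_cancel W V s h := ⟨1, by rw [mul_right_cancel h]⟩
  oreNum W s := (exists_mul_eq_of_mem_powers W s).choose
  oreDenom _ s := s
  ore_eq W s := (exists_mul_eq_of_mem_powers W s).choose_spec

/-- The monoid of fractions of `SBₙ⁺` with the powers of `Δ` as denominators. -/
abbrev PosFractions (n : ℕ) : Type :=
  OreLocalization (Submonoid.powers (posGarside n)) (SBPos n)

/-- The homomorphism `SBₙ⁺ → SBₙ⁺[Δ⁻¹]`. -/
noncomputable def toFractions (n : ℕ) : SBPos n →* PosFractions n :=
  OreLocalization.numeratorHom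

theorem toFractions_injective : Function.Injective (toFractions n) := by
  intro W V h
  rw [toFractions, OreLocalization.numeratorHom_apply, OreLocalization.numeratorHom_apply,
    OreLocalization.oreDiv_eq_iff] at h
  obtain ⟨u, v, h₁, h₂⟩ := h
  simp only [Submonoid.smul_def, smul_eq_mul, OneMemClass.coe_one, mul_one] at h₁ h₂
  rw [h₂] at h₁
  exact (mul_left_cancel h₁).symm

theorem isUnit_toFractions_posGarside : IsUnit (toFractions n (posGarside n)) :=
  OreLocalization.numerator_isUnit (⟨_, Submonoid.mem_powers _⟩ : Submonoid.powers (posGarside n))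

theorem isUnit_toFractions_sPos (i : Fin (n - 1)) : IsUnit (toFractions n (sPos n i)) := by
  obtain ⟨u, hu⟩ := isUnit_toFractions_posGarside (n := n)
  obtain ⟨X, hX⟩ := sPos_dvd_posGarside i
  obtain ⟨Y, hY⟩ := exists_posGarside_eq_mul_sPos i
  rw [isUnit_iff_exists_and_exists]
  constructor
  · exact ⟨toFractions n X * ↑u⁻¹, by rw [← mul_assoc, ← map_mul, ← hX, ← hu, u.mul_inv]⟩
  · exact ⟨↑u⁻¹ * toFractions n Y, by rw [mul_assoc, ← map_mul, ← hY, ← hu, u.inv_mul]⟩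

/-- The extension to `SBₙ` of a homomorphism on `SBₙ⁺` that makes every `σᵢ` invertible. -/
noncomputable def sbLift {M : Type*} [Monoid M] (φ : SBPos n →* M)
    (hφ : ∀ i, IsUnit (φ (sPos n i))) : SB n →* M :=
  PresentedMonoid.lift
    (fun g => match g with
      | Gen.sigma i => φ (sPos n i)
      | Gen.sigmaInv i => ↑(hφ i).unit⁻¹
      | Gen.sing i => φ (xPos n i)) (by
    intro a b h
    cases h with
    | sigma_comm i j h => simpa using congrArg φ (sPos_comm h)
    | sing_comm i j h => simpa using congrArg φ (xPos_comm h)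
    | sing_sigma_comm i j h => simpa using congrArg φ (xPos_mul_sPos h)
    | braid i j h =>
      have h' : |(i : ℤ) - (j : ℤ)| = 1 := by rw [h]; simp
      simpa [mul_assoc] using congrArg φ (sPos_braid h')
    | mixed_up i j h =>
      have h' : |(i : ℤ) - (j : ℤ)| = 1 := by rw [h]; simp
      simpa [mul_assoc] using congrArg φ (sPos_mul_sPos_mul_xPos h')
    | mixed_down i j h =>
      have h' : |(j : ℤ) - (i : ℤ)| = 1 := by rw [h]; simp
      simpa [mul_assoc] using congrArg φ (sPos_mul_sPos_mul_xPos h')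
    | mul_inv i => exact (hφ i).mul_val_inv
    | inv_mul i => exact (hφ i).val_inv_mul)

theorem sbLift_posToSB {M : Type*} [Monoid M] (φ : SBPos n →* M)
    (hφ : ∀ i, IsUnit (φ (sPos n i))) (W : SBPos n) : sbLift φ hφ (posToSB n W) = φ W := by
  have : (sbLift φ hφ).comp (posToSB n) = φ := by
    ext x
    cases x <;> rfl
  exact DFunLike.congr_fun this W

/-- The injective map to the fractions inverts every $\sigma_i$, hence factors through $SB_n$. -/
theorem posToSB_injective : Function.Injective (posToSB n) := fun W V h =>
  toFractions_injective (by
    rw [← sbLift_posToSB (toFractions n) isUnit_toFractions_sPos, h, sbLift_posToSB])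

end Embedding

/-! ### Splitting off the power of Garside's element -/

section Fractions

theorem posToSB_posGarside : posToSB n (posGarside n) = garsideUnit n := by
  have h : (garsideUnit n : SB n) = Units.coeHom (SB n) (garsideUnit n) := rfl
  rw [h, posGarside, garside, garsideUnit, map_list_prod, map_list_prod, map_list_prod,
    List.map_map, List.map_map, List.map_map]
  rfl

/-- Every singular braid becomes positive after multiplication by a power of `Δ`. -/
theorem exists_garside_pow_mul_eq (w : SB n) :
    ∃ (k : ℕ) (W : SBPos n), (garsideUnit n : SB n) ^ k * w = posToSB n W := by
  induction w using presentedMonoid_induction with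
  | one => exact ⟨0, 1, by simp⟩
  | mul a w ih =>
    obtain ⟨k, W, h⟩ := ih
    have pos (X : SBPos n) :
        ∃ (k : ℕ) (W : SBPos n), (garsideUnit n : SB n) ^ k * (posToSB n X * w) = posToSB n W := by
      obtain ⟨V, hV⟩ := exists_pow_posGarside_mul X k
      refine ⟨k, V * W, ?_⟩
      rw [← posToSB_posGarside, ← map_pow, ← mul_assoc, ← map_mul, hV, map_mul, mul_assoc,
        map_pow, posToSB_posGarside, h, map_mul]
    cases a with
    | sigma i => exact pos (sPos n i)
    | sing i => exact pos (xPos n i)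
    | sigmaInv i =>
      -- From $\Delta = Y\sigma_i$ one gets $\Delta\sigma_i^{-1} = Y$: an inverse letter costs one
      -- more power of $\Delta$.
      obtain ⟨Y, hY⟩ := exists_posGarside_eq_mul_sPos i
      obtain ⟨m, V, hV⟩ := pos Y
      refine ⟨m + 1, V, ?_⟩
      have e : (garsideUnit n : SB n) * PresentedMonoid.of _ (Gen.sigmaInv i) = posToSB n Y := by
        rw [← posToSB_posGarside, hY, map_mul, mul_assoc]
        exact (congrArg _ (sigmaUnit n i).mul_inv).trans (mul_one _)
      rw [pow_succ, mul_assoc, ← mul_assoc _ _ w, e, hV]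

/-- Every singular braid is `Δ^t W` for a unique positive `W` not divisible by `Δ`. -/
theorem existsUnique_garside_zpow_mul (hn : 2 ≤ n) (w : SB n) :
    ∃! p : ℤ × SBPos n, ¬ posGarside n ∣ p.2 ∧
      ((garsideUnit n ^ p.1 : (SB n)ˣ) : SB n) * posToSB n p.2 = w := by
  -- Here $n \ge 2$ matters: for $n = 1$ one has $\Delta = 1$, and splitting it off would never end.
  have hpos : 0 < singLen (posGarside n) := by
    obtain ⟨X, hX⟩ := sPos_dvd_posGarside (⟨0, by omega⟩ : Fin (n - 1))
    rw [hX, singLen_mul, singLen_sPos]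
    omega
  have hsplit (W : SBPos n) : ∃ (k : ℕ) (V : SBPos n), ¬ posGarside n ∣ V ∧
      W = posGarside n ^ k * V := by
    induction hN : singLen W using Nat.strong_induction_on generalizing W with | _ N ih
    by_cases h : posGarside n ∣ W
    · obtain ⟨V, rfl⟩ := h
      obtain ⟨k, U, hU, e⟩ := ih (singLen V) (by rw [← hN, singLen_mul]; omega) V rfl
      exact ⟨k + 1, U, hU, by rw [e, pow_succ', mul_assoc]⟩
    · exact ⟨0, W, h, by simp⟩
  have hval (k : ℕ) (W : SBPos n) :
      posToSB n (posGarside n ^ k * W) = ((garsideUnit n ^ k : (SB n)ˣ) : SB n) * posToSB n W := by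
    rw [map_mul, map_pow, posToSB_posGarside, Units.val_pow_eq_pow_val]
  obtain ⟨k, W, hW⟩ := exists_garside_pow_mul_eq w
  obtain ⟨m, V, hV, rfl⟩ := hsplit W
  have hval' : ((garsideUnit n ^ ((m : ℤ) - k) : (SB n)ˣ) : SB n) * posToSB n V = w := by
    rw [hval, ← Units.val_pow_eq_pow_val] at hW
    rw [sub_eq_neg_add, zpow_add, zpow_neg, zpow_natCast, zpow_natCast, Units.val_mul, mul_assoc,
      ← hW, Units.inv_mul_cancel_left]
  refine ⟨((m : ℤ) - k, V), ⟨hV, hval'⟩, ?_⟩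
  -- After cancelling the smaller power, a positive excess `t - s` would make $\Delta$ divide `X`.
  have huniq (s t : ℤ) (X Y : SBPos n) (hX : ¬ posGarside n ∣ X) (hst : s ≤ t)
      (h : ((garsideUnit n ^ s : (SB n)ˣ) : SB n) * posToSB n X =
        ((garsideUnit n ^ t : (SB n)ˣ) : SB n) * posToSB n Y) : s = t ∧ X = Y := by
    obtain ⟨d, rfl⟩ := Int.le.dest hst
    rw [zpow_add, zpow_natCast, Units.val_mul, mul_assoc, Units.mul_right_inj, ← hval] at h
    have e := posToSB_injective h
    rcases d with _ | d
    · simpa using e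
    · exact absurd ⟨_, by rw [e, pow_succ', mul_assoc]⟩ hX
  rintro ⟨t, Y⟩ ⟨hY, h⟩
  rcases le_total t ((m : ℤ) - k) with hle | hle
  · obtain ⟨rfl, rfl⟩ := huniq _ _ _ _ hY hle (h.trans hval'.symm)
    rfl
  · obtain ⟨rfl, rfl⟩ := huniq _ _ _ _ hV hle (hval'.trans h.symm)
    rfl

end Fractions

/-! ### Existence and uniqueness of the left-greedy form -/

section LeftGreedy

theorem eq_of_dvd_of_len_le {A B : BrPos n} (h : A ∣ B) (hl : len B ≤ len A) : B = A := by
  obtain ⟨C, rfl⟩ := h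
  rw [len_mul] at hl
  rw [len_eq_zero.1 (by omega : len C = 0), mul_one]

theorem exists_longest {p : BrPos n → Prop} (h₁ : p 1) (N : ℕ) (hN : ∀ A, p A → len A ≤ N) :
    ∃ S, p S ∧ ∀ A, p A → len A ≤ len S := by
  have hb : BddAbove (len '' {A | p A}) := ⟨N, by rintro _ ⟨A, hA, rfl⟩; exact hN A hA⟩
  obtain ⟨S, hS, e⟩ := Nat.sSup_mem (Set.Nonempty.image len ⟨1, h₁⟩) hb
  exact ⟨S, hS, fun A hA => e ▸ le_csSup hb ⟨A, hA, rfl⟩⟩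

theorem exists_isMaxLeftBraidDivisor (W : SBPos n) : ∃ S, IsMaxLeftBraidDivisor S W := by
  obtain ⟨S, hS, h⟩ := exists_longest (p := fun S => ∃ T, W = brToSing n S * T) ⟨W, by simp⟩
    (singLen W) (by rintro A ⟨T, rfl⟩; simp)
  exact ⟨S, hS, fun A V e => h A ⟨V, e⟩⟩

/-- A common multiple of the two that still divides `W` cannot be longer than either, so both are
equal to it. -/
theorem IsMaxLeftBraidDivisor.unique {S S' : BrPos n} {W : SBPos n}
    (h : IsMaxLeftBraidDivisor S W) (h' : IsMaxLeftBraidDivisor S' W) : S = S' := by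
  obtain ⟨C, hC, hC', ⟨V, hV⟩, -⟩ := exists_common_multiple h.1 h.1 h'.1 h'.1
  rw [← eq_of_dvd_of_len_le hC (h.2 C V hV), eq_of_dvd_of_len_le hC' (h'.2 C V hV)]

theorem exists_isLongestLeftFragment (P : BrPos n) : ∃ A, IsLongestLeftFragment A P := by
  obtain ⟨A, hA, h⟩ := exists_longest (p := fun A => IsFragment A ∧ ∃ Q, P = A * Q)
    ⟨isFragment_iff_dvd.2 (one_dvd _), P, by simp⟩ (len P) (by rintro A ⟨-, Q, rfl⟩; simp)
  exact ⟨A, hA.1, hA.2, fun B hB hB' => h B ⟨hB, hB'⟩⟩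

/-- The common multiple is taken below `P` and $\Delta$ simultaneously, so it is again a fragment.
-/
theorem IsLongestLeftFragment.unique {A A' P : BrPos n}
    (h : IsLongestLeftFragment A P) (h' : IsLongestLeftFragment A' P) : A = A' := by
  obtain ⟨C, hC, hC', hCP, hCΔ⟩ := exists_common_multiple
    (brToSing_dvd_brToSing.2 h.2.1) (brToSing_dvd_brToSing.2 (isFragment_iff_dvd.1 h.1))
    (brToSing_dvd_brToSing.2 h'.2.1) (brToSing_dvd_brToSing.2 (isFragment_iff_dvd.1 h'.1))
  rw [brToSing_dvd_brToSing] at hCP hCΔ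
  rw [← isFragment_iff_dvd] at hCΔ
  rw [← eq_of_dvd_of_len_le hC (h.2.2 C hCΔ hCP), eq_of_dvd_of_len_le hC' (h'.2.2 C hCΔ hCP)]

theorem prod_ne_one_of_isLeftGreedyBraid {L : List (BrPos n)} (hL : L ≠ [])
    (h : IsLeftGreedyBraid L) : L.prod ≠ 1 := by
  cases L with
  | nil => exact absurd rfl hL
  | cons A L =>
    intro e
    have := congrArg len e
    rw [List.prod_cons, len_mul, len_one] at this
    exact h.1 (len_eq_zero.1 (by omega))

theorem IsLeftGreedyBraid.unique {L L' : List (BrPos n)} (h : IsLeftGreedyBraid L)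
    (h' : IsLeftGreedyBraid L') (e : L.prod = L'.prod) : L = L' := by
  induction L generalizing L' with
  | nil =>
    by_contra hne
    exact prod_ne_one_of_isLeftGreedyBraid (Ne.symm hne) h' e.symm
  | cons A L ih =>
    cases L' with
    | nil => exact absurd e (prod_ne_one_of_isLeftGreedyBraid (List.cons_ne_nil _ _) h)
    | cons A' L' =>
      rw [List.prod_cons, List.prod_cons] at e
      have h₁ := h'.2.1
      rw [← e] at h₁
      obtain rfl := h.2.1.unique h₁
      rw [ih h.2.2 h'.2.2 (mul_left_cancel e)]

theorem exists_isLeftGreedyBraid (S : BrPos n) : ∃ L, IsLeftGreedyBraid L ∧ L.prod = S := by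
  induction hN : len S using Nat.strong_induction_on generalizing S with | _ N ih
  subst hN
  by_cases hS : S = 1
  · exact ⟨[], trivial, hS.symm⟩
  · obtain ⟨A, hA⟩ := exists_isLongestLeftFragment S
    obtain ⟨Q, rfl⟩ := hA.2.1
    -- Every $\sigma_i$ is a fragment, so the first letter of a non-trivial braid already beats `1`.
    have hA1 : A ≠ 1 := by
      rintro rfl
      induction Q using presentedMonoid_induction with
      | one => exact hS (mul_one _)
      | mul i Q _ =>
        have := hA.2.2 _ (isFragment_iff_dvd.2 (of_dvd_garside i)) ⟨Q, one_mul _⟩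
        simp at this
    have hlen : 0 < len A := Nat.pos_of_ne_zero fun h => hA1 (len_eq_zero.1 h)
    obtain ⟨L, hL, rfl⟩ := ih (len Q) (by simp [hlen]) Q rfl
    exact ⟨A :: L, ⟨hA1, hA, hL⟩, rfl⟩

theorem leftSingProd_cons (i : Fin (n - 1)) (L : List (Fin (n - 1))) (R : SBPos n) :
    leftSingProd (i :: L) * R = xPos n i * (leftSingProd L * R) := by
  simp [leftSingProd, mul_assoc]

theorem leftSingProd_nil (R : SBPos n) : leftSingProd [] * R = R := by simp [leftSingProd]

theorem singLen_leftSingProd (L : List (Fin (n - 1))) : singLen (leftSingProd L) = L.length := by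
  induction L with
  | nil => simp [leftSingProd]
  | cons i L ih => rw [← mul_one (leftSingProd (i :: L)), leftSingProd_cons]; simp [ih, add_comm]

/-- The singular word of a block is determined, if it can only be followed by `1` or by a product
from which a braid splits off. -/
theorem IsLeftSingOrdered.unique {L L' : List (Fin (n - 1))} {R R' : SBPos n}
    (h : IsLeftSingOrdered L R) (h' : IsLeftSingOrdered L' R')
    (hR : IsMaxLeftBraidDivisor 1 R → R = 1) (hR' : IsMaxLeftBraidDivisor 1 R' → R' = 1)
    (hL : L = [] → R = 1) (hL' : L' = [] → R' = 1)
    (e : leftSingProd L * R = leftSingProd L' * R') : L = L' ∧ R = R' := by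
  have hlen := congrArg singLen e
  simp only [singLen_mul, singLen_leftSingProd] at hlen
  induction L generalizing L' with
  | nil =>
    rw [hL rfl] at hlen ⊢
    simp only [List.length_nil, singLen_one] at hlen
    obtain rfl := List.length_eq_zero_iff.1 (by omega : L'.length = 0)
    exact ⟨rfl, (hL' rfl).symm⟩
  | cons i L ih =>
    cases L' with
    | nil =>
      rw [hL' rfl] at hlen
      simp at hlen
    | cons j L' =>
      obtain rfl : i = j := by
        apply le_antisymm
        · exact h.1 j _ (e.trans (leftSingProd_cons j L' R'))
        · exact h'.1 i _ (e.symm.trans (leftSingProd_cons i L R))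
      rw [leftSingProd_cons, leftSingProd_cons] at e
      have e' := mul_left_cancel e
      simp only [List.length_cons] at hlen
      -- If one word stops where the other continues, no braid divides the remainder `R`, which `hR`
      -- then forces to be `1`.
      have hnil : L = [] → R = 1 ∨ L' = [] := by
        rintro rfl
        by_cases hne : L' = []
        · exact .inr hne
        · rw [leftSingProd_nil] at e'
          exact .inl (hR (e' ▸ h'.2.1 hne))
      have hnil' : L' = [] → R' = 1 ∨ L = [] := by
        rintro rfl
        by_cases hne : L = []
        · exact .inr hne
        · rw [leftSingProd_nil] at e'
          exact .inl (hR' (e' ▸ h.2.1 hne))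
      by_cases hboth : L = [] ∧ L' = []
      · obtain ⟨rfl, rfl⟩ := hboth
        rw [leftSingProd_nil, leftSingProd_nil] at e'
        exact ⟨rfl, e'⟩
      · obtain ⟨h₁, h₂⟩ := ih h.2.2 h'.2.2
          (fun h0 => (hnil h0).resolve_right fun h1 => hboth ⟨h0, h1⟩)
          (fun h0 => (hnil' h0).resolve_right fun h1 => hboth ⟨h1, h0⟩) e' (by omega)
        exact ⟨by rw [h₁], h₂⟩

/-- As no braid divides `P`, it starts with a singular letter unless it is `1`. The smallest one is
split off, and this is repeated until the rest is `1` or has a non-trivial braid divisor. -/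
theorem exists_isLeftSingOrdered (P : SBPos n) (hP : IsMaxLeftBraidDivisor 1 P) :
    ∃ L R, P = leftSingProd L * R ∧ IsLeftSingOrdered L R ∧
      (IsMaxLeftBraidDivisor 1 R → R = 1) ∧ (L = [] → R = 1) := by
  induction hN : singLen P using Nat.strong_induction_on generalizing P with | _ N ih
  subst hN
  by_cases hP1 : P = 1
  · exact ⟨[], 1, by simp [leftSingProd, hP1], trivial, fun _ => rfl, fun _ => rfl⟩
  · have hex : ∃ i V, P = xPos n i * V := by
      induction P using SBPos.induction_left with
      | one => exact absurd rfl hP1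
      | mul a V _ =>
        obtain ⟨k, i⟩ := a
        cases k with
        | false => exact ⟨i, V, rfl⟩
        | true =>
          have := hP.2 (PresentedMonoid.of _ i) V rfl
          simp at this
    obtain ⟨i, ⟨V, rfl⟩, hi⟩ :=
      WellFounded.has_min (α := Fin (n - 1)) wellFounded_lt {i | ∃ V, P = xPos n i * V} hex
    have hmin : ∀ j U, xPos n i * V = xPos n j * U → i ≤ j := fun j U h =>
      not_lt.1 (hi j ⟨U, h⟩)
    by_cases hV : IsMaxLeftBraidDivisor 1 V ∧ V ≠ 1
    · obtain ⟨L, R, rfl, hL, hR, hnil⟩ := ih (singLen V) (by simp) V hV.1 rfl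
      refine ⟨i :: L, R, (leftSingProd_cons i L R).symm, ⟨?_, fun _ => hV.1, hL⟩, hR, by simp⟩
      intro j U h
      exact hmin j U (by rw [← h, leftSingProd_cons])
    · refine ⟨[i], V, by rw [leftSingProd_cons, leftSingProd_nil], ⟨?_, by simp, trivial⟩,
        fun h => by_contra fun h1 => hV ⟨h, h1⟩, by simp⟩
      intro j U h
      exact hmin j U (by rw [← h, leftSingProd_cons, leftSingProd_nil])

theorem reduced_cons_iff {b : Block n} {bs : List (Block n)} :
    Reduced (b :: bs) ↔ (b.frags ≠ [] ∨ b.sings ≠ []) ∧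
      (∀ c ∈ bs.head?, b.sings ≠ [] ∧ c.frags ≠ []) ∧ Reduced bs := by
  simp only [Reduced, List.mem_cons, forall_eq_or_imp, List.isChain_cons]
  tauto

theorem leftProd_cons_ne_one {b : Block n} {bs : List (Block n)}
    (hb : b.frags ≠ [] ∨ b.sings ≠ []) (h : IsLeftGreedyBraid b.frags) :
    leftProd (b :: bs) ≠ 1 := by
  intro e
  have := congrArg singLen e
  simp only [leftProd, singLen_mul, singLen_one, singLen_brToSing, singLen_leftSingProd] at this
  rcases hb with hb | hb
  · exact prod_ne_one_of_isLeftGreedyBraid hb h (len_eq_zero.1 (by omega))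
  · exact hb (List.length_eq_zero_iff.1 (by omega))

/-- A block following another one has a non-empty braid part, whose product is the maximal braid
divisor and is not `1`. -/
theorem leftProd_eq_one_of_isMax {b : Block n} {bs : List (Block n)} (hr : Reduced (b :: bs))
    (h : IsLeftGreedyBlocks bs) (hmax : IsMaxLeftBraidDivisor 1 (leftProd bs)) :
    leftProd bs = 1 := by
  cases bs with
  | nil => rfl
  | cons c cs =>
    have hc := ((reduced_cons_iff.1 hr).2.1 c rfl).2
    exact absurd (h.1.unique hmax) (prod_ne_one_of_isLeftGreedyBraid hc h.2.1)

theorem IsLeftGreedyBlocks.unique {bs cs : List (Block n)} (h : IsLeftGreedyBlocks bs)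
    (h' : IsLeftGreedyBlocks cs) (hr : Reduced bs) (hr' : Reduced cs)
    (e : leftProd bs = leftProd cs) : bs = cs := by
  induction bs generalizing cs with
  | nil =>
    cases cs with
    | nil => rfl
    | cons c cs =>
      exact absurd e.symm (leftProd_cons_ne_one (reduced_cons_iff.1 hr').1 h'.2.1)
  | cons b bs ih =>
    cases cs with
    | nil => exact absurd e (leftProd_cons_ne_one (reduced_cons_iff.1 hr).1 h.2.1)
    | cons c cs =>
      have h₁ := h'.1
      rw [← e] at h₁
      have hS := h.1.unique h₁
      have hF := h.2.1.unique h'.2.1 hS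
      simp only [leftProd, mul_assoc] at e
      rw [hS] at e
      have hnil {b : Block n} {bs : List (Block n)} (hr : Reduced (b :: bs)) (hb : b.sings = []) :
          leftProd bs = 1 := by
        cases bs with
        | nil => rfl
        | cons c cs => exact absurd hb ((reduced_cons_iff.1 hr).2.1 c rfl).1
      obtain ⟨hX, hR⟩ := h.2.2.1.unique h'.2.2.1 (leftProd_eq_one_of_isMax hr h.2.2.2)
        (leftProd_eq_one_of_isMax hr' h'.2.2.2) (hnil hr) (hnil hr') (mul_left_cancel e)
      rw [ih h.2.2.2 h'.2.2.2 (reduced_cons_iff.1 hr).2.2 (reduced_cons_iff.1 hr').2.2 hR]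
      obtain ⟨bf, bx⟩ := b
      obtain ⟨cf, cx⟩ := c
      simp only at hF hX
      rw [hF, hX]

theorem exists_isLeftGreedyBlocks (P : SBPos n) :
    ∃ bs, Reduced bs ∧ IsLeftGreedyBlocks bs ∧ leftProd bs = P := by
  induction hN : singLen P using Nat.strong_induction_on generalizing P with | _ N ih
  subst hN
  by_cases hP : P = 1
  · exact ⟨[], ⟨by simp, by simp⟩, trivial, hP.symm⟩
  · obtain ⟨S, hS⟩ := exists_isMaxLeftBraidDivisor P
    obtain ⟨V, hV⟩ := hS.1
    -- A braid dividing the remainder could be appended to `S`, against maximality.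
    have hV1 : IsMaxLeftBraidDivisor 1 V := by
      refine ⟨⟨V, by simp⟩, fun A U h => ?_⟩
      have := hS.2 (S * A) U (by rw [hV, h, map_mul, mul_assoc])
      rw [len_mul] at this
      omega
    obtain ⟨X, R, rfl, hX, hR, hnil⟩ := exists_isLeftSingOrdered V hV1
    obtain ⟨L, hL, rfl⟩ := exists_isLeftGreedyBraid S
    have hne : L ≠ [] ∨ X ≠ [] := by
      by_contra! hc
      obtain ⟨rfl, rfl⟩ := hc
      exact hP (by rw [hV, hnil rfl]; simp [leftSingProd])
    have hlt : singLen R < singLen P := by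
      rw [hV]
      simp only [singLen_mul, singLen_brToSing, singLen_leftSingProd]
      rcases hne with h | h
      · have := Nat.pos_of_ne_zero fun h0 =>
          prod_ne_one_of_isLeftGreedyBraid h hL (len_eq_zero.1 h0)
        omega
      · have := List.length_pos_iff.2 h
        omega
    obtain ⟨bs, hbs, hg, rfl⟩ := ih _ hlt R rfl
    have hP' : leftProd (⟨L, X⟩ :: bs) = P := by rw [hV, leftProd, mul_assoc]
    refine ⟨⟨L, X⟩ :: bs, reduced_cons_iff.2 ⟨hne, ?_, hbs⟩, ⟨hP' ▸ hS, hL, hX, hg⟩, hP'⟩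
    intro c hc
    cases bs with
    | nil => simp at hc
    | cons c' cs =>
      obtain rfl : c' = c := by simpa using hc
      have h1 := leftProd_cons_ne_one (reduced_cons_iff.1 hbs).1 hg.2.1 (bs := cs)
      -- An empty part at this junction would force the remaining product to be `1`, although a
      -- further block exists.
      refine ⟨fun h => h1 (hnil h), fun h => h1 (hR ?_)⟩
      have := hg.1
      rwa [h, List.prod_nil] at this

theorem existsUnique_isLeftGreedy (hn : 2 ≤ n) (w : SB n) :
    ∃! F : GreedyForm n, F.IsLeftGreedy ∧ F.leftValue = w := by
  obtain ⟨⟨t, P⟩, ⟨hP, hw⟩, huniq⟩ := existsUnique_garside_zpow_mul hn w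
  obtain ⟨bs, hr, hg, rfl⟩ := exists_isLeftGreedyBlocks P
  refine ⟨⟨t, bs⟩, ⟨⟨hP, hr, hg⟩, hw⟩, ?_⟩
  rintro ⟨t', cs⟩ ⟨⟨hP', hr', hg'⟩, hw'⟩
  have e := huniq (t', leftProd cs) ⟨hP', hw'⟩
  simp only [Prod.mk.injEq] at e
  obtain rfl : cs = bs := IsLeftGreedyBlocks.unique hg' hg hr' hr e.2
  rw [e.1]

end LeftGreedy

/-! ### The right-greedy form by reversal -/

section RightGreedy

theorem posRev_injective : Function.Injective (posRev (n := n)) :=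
  Function.LeftInverse.injective posRev_posRev

theorem brRev_injective : Function.Injective (brRev (n := n)) :=
  Function.LeftInverse.injective brRev_brRev

theorem brRev_eq_iff {A B : BrPos n} : brRev A = B ↔ A = brRev B :=
  ⟨fun h => by rw [← h, brRev_brRev], fun h => by rw [h, brRev_brRev]⟩

@[simp] theorem len_brRev (A : BrPos n) : len (brRev A) = len A := by
  induction A using presentedMonoid_induction with
  | one => simp
  | mul a A ih => simp [ih, add_comm]

theorem exists_posRev {p : SBPos n → Prop} : (∃ W, p (posRev W)) ↔ ∃ W, p W :=
  ⟨fun ⟨W, h⟩ => ⟨_, h⟩, fun ⟨W, h⟩ => ⟨posRev W, by rwa [posRev_posRev]⟩⟩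

theorem exists_brRev {p : BrPos n → Prop} : (∃ A, p (brRev A)) ↔ ∃ A, p A :=
  ⟨fun ⟨A, h⟩ => ⟨_, h⟩, fun ⟨A, h⟩ => ⟨brRev A, by rwa [brRev_brRev]⟩⟩

theorem forall_posRev {p : SBPos n → Prop} : (∀ W, p (posRev W)) ↔ ∀ W, p W :=
  ⟨fun h W => by simpa using h (posRev W), fun h W => h _⟩

theorem forall_brRev {p : BrPos n → Prop} : (∀ A, p (brRev A)) ↔ ∀ A, p A :=
  ⟨fun h A => by simpa using h (brRev A), fun h A => h _⟩

theorem isMaxLeftBraidDivisor_rev {S : BrPos n} {W : SBPos n} :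
    IsMaxLeftBraidDivisor (brRev S) (posRev W) ↔ IsMaxRightBraidDivisor S W := by
  unfold IsMaxLeftBraidDivisor IsMaxRightBraidDivisor
  rw [← exists_posRev, ← forall_brRev]
  refine and_congr (exists_congr fun T => ?_) (forall_congr' fun A => ?_)
  · rw [← posRev_brToSing, ← posRev_mul, posRev_injective.eq_iff]
  · rw [← forall_posRev]
    simp only [← posRev_brToSing, ← posRev_mul, posRev_injective.eq_iff, len_brRev]

theorem isLongestLeftFragment_rev {A P : BrPos n} :
    IsLongestLeftFragment (brRev A) (brRev P) ↔ IsLongestRightFragment A P := by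
  unfold IsLongestLeftFragment IsLongestRightFragment
  rw [isFragment_brRev_iff, ← exists_brRev, ← forall_brRev]
  simp only [← brRev_mul, brRev_injective.eq_iff, isFragment_brRev_iff, len_brRev]
  refine and_congr Iff.rfl (and_congr Iff.rfl (forall_congr' fun B => ?_))
  rw [← exists_brRev]
  simp only [← brRev_mul, brRev_injective.eq_iff]

theorem prod_map_brRev (L : List (BrPos n)) : (L.map brRev).prod = brRev L.reverse.prod := by
  induction L with
  | nil => simp
  | cons A L ih => simp [ih]

theorem isLeftGreedyBraid_rev {L : List (BrPos n)} :
    IsLeftGreedyBraid (L.map brRev) ↔ IsRightGreedyBraid L := by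
  induction L with
  | nil => rfl
  | cons A L ih =>
    rw [List.map_cons, IsLeftGreedyBraid, IsRightGreedyBraid, ih, prod_map_brRev, ← brRev_mul,
      isLongestLeftFragment_rev, ne_eq, brRev_eq_iff, brRev_one]

theorem leftSingProd_eq_posRev (L : List (Fin (n - 1))) :
    leftSingProd L = posRev (rightSingProd L) := by
  induction L with
  | nil => simp [leftSingProd, rightSingProd]
  | cons i L ih =>
    have h₁ : leftSingProd (i :: L) = xPos n i * leftSingProd L := by simp [leftSingProd]
    have h₂ : rightSingProd (i :: L) = rightSingProd L * xPos n i := by simp [rightSingProd]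
    rw [h₁, h₂, ih, posRev_mul, posRev_xPos]

/-- The index list is unchanged, because both versions list letters in the order in which they are
split off. -/
theorem isLeftSingOrdered_rev {L : List (Fin (n - 1))} {R : SBPos n} :
    IsLeftSingOrdered L (posRev R) ↔ IsRightSingOrdered L R := by
  induction L with
  | nil => rfl
  | cons i L ih =>
    rw [IsLeftSingOrdered, IsRightSingOrdered, ih, leftSingProd_eq_posRev, leftSingProd_eq_posRev,
      ← posRev_mul, ← posRev_mul, ← brRev_one, isMaxLeftBraidDivisor_rev]
    refine and_congr (forall_congr' fun j => ?_) Iff.rfl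
    rw [← forall_posRev]
    refine forall_congr' fun V => ?_
    have h : xPos n j * posRev V = posRev (V * xPos n j) := by simp
    rw [h, posRev_injective.eq_iff]

/-- The mirror image of a block. -/
def Block.rev (b : Block n) : Block n := ⟨b.frags.map brRev, b.sings⟩

/-- The mirror image of a form. -/
def GreedyForm.rev (F : GreedyForm n) : GreedyForm n := ⟨F.power, F.blocks.map Block.rev⟩

theorem Block.rev_rev (b : Block n) : b.rev.rev = b := by
  obtain ⟨f, x⟩ := b
  simp [Block.rev, Function.comp_def]

theorem GreedyForm.rev_rev (F : GreedyForm n) : F.rev.rev = F := by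
  obtain ⟨t, bs⟩ := F
  simp [GreedyForm.rev, Function.comp_def, Block.rev_rev]

theorem leftProd_map_rev (bs : List (Block n)) :
    leftProd (bs.map Block.rev) = posRev (rightProd bs) := by
  induction bs with
  | nil => simp [leftProd, rightProd]
  | cons b bs ih =>
    simp [leftProd, rightProd, ih, Block.rev, prod_map_brRev, posRev_brToSing,
      leftSingProd_eq_posRev, mul_assoc]

theorem isLeftGreedyBlocks_rev {bs : List (Block n)} :
    IsLeftGreedyBlocks (bs.map Block.rev) ↔ IsRightGreedyBlocks bs := by
  induction bs with
  | nil => rfl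
  | cons b bs ih =>
    rw [List.map_cons, IsLeftGreedyBlocks, IsRightGreedyBlocks, ih, ← List.map_cons,
      leftProd_map_rev, leftProd_map_rev, Block.rev, prod_map_brRev, isMaxLeftBraidDivisor_rev,
      isLeftGreedyBraid_rev, isLeftSingOrdered_rev]

theorem reduced_map_rev {bs : List (Block n)} : Reduced (bs.map Block.rev) ↔ Reduced bs := by
  simp [Reduced, List.isChain_map, Block.rev]

theorem isLeftGreedy_rev {F : GreedyForm n} : F.rev.IsLeftGreedy ↔ F.IsRightGreedy := by
  have h : (∃ Z, leftProd F.rev.blocks = brToSing n (garside n) * Z) ↔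
      ∃ Z, rightProd F.blocks = Z * brToSing n (garside n) := by
    rw [← exists_posRev]
    refine exists_congr fun Z => ?_
    conv_lhs => rw [← brRev_garside, ← posRev_brToSing, ← posRev_mul]
    exact (leftProd_map_rev F.blocks).congr_left.trans posRev_injective.eq_iff
  unfold GreedyForm.IsLeftGreedy GreedyForm.IsRightGreedy
  rw [h]
  exact and_congr Iff.rfl (and_congr reduced_map_rev isLeftGreedyBlocks_rev)

theorem sbRev_garsideUnit_zpow (t : ℤ) :
    sbRev ((garsideUnit n ^ t : (SB n)ˣ) : SB n) = ((garsideUnit n ^ t : (SB n)ˣ) : SB n) := by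
  -- Reversal is lifted to the unit group so that it commutes with integer powers.
  let f : (SB n)ˣ →* (SB n)ˣᵐᵒᵖ :=
    (Units.opEquiv (M := SB n)).toMonoidHom.comp (Units.map (sbRevHom n))
  have hf (u : (SB n)ˣ) : ((f u).unop : SB n) = sbRev u := rfl
  have h : f (garsideUnit n) = MulOpposite.op (garsideUnit n) := by
    apply MulOpposite.unop_injective
    apply Units.ext
    rw [hf, ← posToSB_posGarside, sbRev_posToSB, posRev_posGarside, posToSB_posGarside]
    rfl
  rw [← hf, map_zpow, h, ← MulOpposite.op_zpow, MulOpposite.unop_op]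

theorem leftValue_rev (F : GreedyForm n) : F.rev.leftValue = sbRev F.rightValue := by
  rw [GreedyForm.leftValue, GreedyForm.rightValue, sbRev_mul, sbRev_garsideUnit_zpow,
    sbRev_posToSB, ← leftProd_map_rev]
  rfl

theorem existsUnique_isRightGreedy (hn : 2 ≤ n) (w : SB n) :
    ∃! F : GreedyForm n, F.IsRightGreedy ∧ F.rightValue = w := by
  obtain ⟨F, ⟨hF, hv⟩, huniq⟩ := existsUnique_isLeftGreedy hn (sbRev w)
  refine ⟨F.rev, ⟨?_, ?_⟩, ?_⟩
  · rwa [← isLeftGreedy_rev, GreedyForm.rev_rev]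
  · have := leftValue_rev F.rev
    rw [GreedyForm.rev_rev, hv] at this
    simpa using (congrArg sbRev this).symm
  · rintro G ⟨hG, rfl⟩
    rw [← huniq G.rev ⟨isLeftGreedy_rev.2 hG, leftValue_rev G⟩, GreedyForm.rev_rev]

end RightGreedy

end SingularBraid

theorem mainTheorem3 (n : ℕ) (hn : 2 ≤ n) :
    (∀ w : SingularBraid.SB n, ∃! F : SingularBraid.GreedyForm n,
      F.IsLeftGreedy ∧ F.leftValue = w) ∧
    (∀ w : SingularBraid.SB n, ∃! F : SingularBraid.GreedyForm n,
      F.IsRightGreedy ∧ F.rightValue = w) :=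
  ⟨SingularBraid.existsUnique_isLeftGreedy hn, SingularBraid.existsUnique_isRightGreedy hn⟩
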